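/- Let $\lambda$ be a regular infinite cardinal and $\mathcal C$ a locally $\lambda$-presentable category. A morphism $f\colon A\to B$ of $\mathcal C$ is called $\lambda$-presentable if it is a $\lambda$-presentable object of the comma category $A\downarrow\mathcal C$. For a morphism $n\colon A\to B$ and an object $K$ write $n\mathbin{\triangledown}K$ (respectively $n\perp K$) if for every $u\colon A\to K$ there is a (respectively a unique) $w\colon B\to K$ with $wn=u$. For a class $\mathcal N$ of morphisms let $\mathcal N^{\vartriangle}$ (respectively $\mathcal N^{\perp}$) be the class of objects $K$ with $n\mathbin{\triangledown}K$ (respectively $n\perp K$) for all $n\in\mathcal N$; for a class $\mathcal K$ of objects let $\mathcal K^{\triangledown}$ (respectively $\mathcal K^{\top}$) be the class of morphisms $n$ with $n\mathbin{\triangledown}K$ (respectively $n\perp K$) for all $K\in\mathcal K$. For morphisms $p,i$ write $p\mathbin{\Box}i$ (respectively $p\perp i$) if every commutative square $vp=iu$ has a (respectively a unique) diagonal $w$ with $wp=u$ and $iw=v$. Put $$\mathcal N^{\Box}=\{i\mid p\mathbin{\Box}i\ \forall p\in\mathcal N\},\quad {}^{\Box}\mathcal N=\{p\mid p\mathbin{\Box}i\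 \forall i\in\mathcal N\},\quad \mathcal N^{\downarrow}=\{i\mid p\perp i\ \forall p\in\mathcal N\},\quad \mathcal N^{\uparrow}=\{p\mid p\perp i\ \forall i\in\mathcal N\}.$$ A pair $(\mathcal E,\mathcal R)$ of classes of morphisms is a weak factorization system (respectively a factorization system) if ${}^{\Box}\mathcal R=\mathcal E$ and $\mathcal E^{\Box}=\mathcal R$ (respectively $\mathcal R^{\uparrow}=\mathcal E$ and $\mathcal E^{\downarrow}=\mathcal R$) and every morphism $f$ factors as $f=me$ with $e\in\mathcal E$ and $m\in\mathcal R$. A weak factorization system is functorial if such factorizations can be chosen functorially: the middle object is the value of a functor on the category of morphisms of $\mathcal C$, and $e$, $m$ are natural in $f$. For a class $\mathcal N$ of morphisms: * $\mathrm{Ch}(\mathcal N)$ is the class of transfinite compositions (indexed by small nonzero ordinals) of members of $\mathcal N$; * $\mathrm{Re}(\mathcal N)$ is the class of morphisms $f\colon A\to B$ that are a retract, in $A\downarrow\mathcal C$, of some member of $\mathcal N$ with domain $A$, and $\mathrm{ReCh}(\mathcal N)=\mathrm{Re}(\mathrm{Ch}(\mathcal N))$; * $A\downarrow\mathcal N$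 is the full subcategory of $A\downarrow\mathcal C$ on the members of $\mathcal N$ with domain $A$, and $\mathrm{Fc}_\lambda(\mathcal N)$ is the class of all canonical morphisms $A\to\operatorname{colim}U_{\mathcal D}$, where $\mathcal D$ is a small $\lambda$-filtered subcategory of some $A\downarrow\mathcal N$ and $U_{\mathcal D}\colon\mathcal D\to\mathcal C$ sends $n\colon A\to X$ to $X$. Here the same morphism may occur several times as an object of $\mathcal D$, that is, a subcategory means a small category $\mathcal D$ with a faithful functor $\mathcal D\to A\downarrow\mathcal N$. **Theorem.** Let $\mathcal M$ be a class of $\lambda$-presentable morphisms of $\mathcal C$. Let $\mathcal N$ be the class of all $\lambda$-presentable morphisms in $(\mathcal M^{\vartriangle})^{\triangledown}$ and $\mathcal N_1$ the class of all $\lambda$-presentable morphisms in $(\mathcal M^{\perp})^{\top}$. Then (a) $(\mathrm{ReCh}(\mathcal N),\mathcal N^{\Box})$ is a functorial weak factorization system; (b) $(\mathrm{Fc}_\lambda(\mathcal N_1),\mathcal N_1^{\downarrow})$ is a factorization system. -/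

import Mathlib

open CategoryTheory CategoryTheory.Limits

universe w v u

namespace PresentableMorphisms

variable {C : Type u} [Category.{v} C]

/-- The class of all `κ`-presentable morphisms: `f : A ⟶ B` is `κ`-presentable if it is a
`κ`-presentable object of the comma category `A ↓ C` (`Under A` in Mathlib). -/
def presentableMorphisms (C : Type u) [Category.{v} C]
    (κ : Cardinal.{w}) [Fact κ.IsRegular] : MorphismProperty C :=
  fun A _ f => IsCardinalPresentable (C := Under A) (Under.mk f) κ

/-- `κ-N`: the class of all `κ`-presentable morphisms which belong to `N`. -/
def presentableMembers (N : MorphismProperty C) (κ : Cardinal.{w}) [Fact κ.IsRegular] :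
    MorphismProperty C :=
  fun _ _ f => N f ∧ presentableMorphisms C κ f

/-- `n ▽ K`: the object `K` is injective with respect to the morphism `n`. -/
def IsInjectiveWrt {A B : C} (n : A ⟶ B) (K : C) : Prop :=
  ∀ u : A ⟶ K, ∃ t : B ⟶ K, n ≫ t = u

/-- `n ⊥ K`: the object `K` is orthogonal to the morphism `n`. -/
def IsOrthogonalTo {A B : C} (n : A ⟶ B) (K : C) : Prop :=
  ∀ u : A ⟶ K, ∃! t : B ⟶ K, n ≫ t = u

/-- `N^△`: the class of objects which are injective with respect to all members of `N`. -/
def injectiveObjects (N : MorphismProperty C) : ObjectProperty C :=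
  fun K => ∀ ⦃A B : C⦄ (n : A ⟶ B), N n → IsInjectiveWrt n K

/-- `N^⊥`: the class of objects which are orthogonal to all members of `N`. -/
def orthogonalObjects (N : MorphismProperty C) : ObjectProperty C :=
  fun K => ∀ ⦃A B : C⦄ (n : A ⟶ B), N n → IsOrthogonalTo n K

/-- `𝒦^▽`: the class of morphisms with respect to which all members of `𝒦` are injective. -/
def injectiveMorphisms (P : ObjectProperty C) : MorphismProperty C :=
  fun _ _ n => ∀ K : C, P K → IsInjectiveWrt n K

/-- `𝒦^⊤`: the class of morphisms to which all members of `𝒦` are orthogonal. -/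
def orthogonalMorphisms (P : ObjectProperty C) : MorphismProperty C :=
  fun _ _ n => ∀ K : C, P K → IsOrthogonalTo n K

/-- `p ⊥ i` for morphisms: every commutative square from `p` to `i` has a unique diagonal. -/
def UniqueLifting {A B X Y : C} (p : A ⟶ B) (i : X ⟶ Y) : Prop :=
  ∀ (s : A ⟶ X) (t : B ⟶ Y), s ≫ i = p ≫ t → ∃! d : B ⟶ X, p ≫ d = s ∧ d ≫ i = t

/-- `N^↑`: the morphisms `p` with `p ⊥ i` for all `i` in `N`. -/
def orthogonalLeft (N : MorphismProperty C) : MorphismProperty C :=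
  fun _ _ p => ∀ ⦃X Y : C⦄ (i : X ⟶ Y), N i → UniqueLifting p i

/-- `N^↓`: the morphisms `i` with `p ⊥ i` for all `p` in `N`. -/
def orthogonalRight (N : MorphismProperty C) : MorphismProperty C :=
  fun _ _ i => ∀ ⦃A B : C⦄ (p : A ⟶ B), N p → UniqueLifting p i

/-- `(E, R)` is an (orthogonal) factorization system. (The corresponding notion of a weak
factorization system is `CategoryTheory.MorphismProperty.IsWeakFactorizationSystem`.) -/
structure IsFactorizationSystem (E R : MorphismProperty C) : Prop where
  orthogonalLeft_eq : orthogonalLeft R = E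
  orthogonalRight_eq : orthogonalRight E = R
  exists_factorization : ∀ ⦃A B : C⦄ (f : A ⟶ B),
    ∃ (X : C) (e : A ⟶ X) (m : X ⟶ B), E e ∧ R m ∧ e ≫ m = f

/-- `Ch(N)`: the class of all transfinite compositions of members of `N`, indexed by `w`-small
nonempty well-ordered sets (equivalently, by small nonzero ordinals). -/
def chains (N : MorphismProperty C) : MorphismProperty C :=
  MorphismProperty.transfiniteCompositions.{w} N

/-- `Re(N)`: the morphisms `f : A ⟶ B` which are a retract, in the comma category `A ↓ C`, of
a member of `N` with domain `A`. -/
def commaRetracts (N : MorphismProperty C) : MorphismProperty C :=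
  fun A _ f => ∃ (X : C) (g : A ⟶ X), N g ∧ Nonempty (Retract (Under.mk f) (Under.mk g))

/-- `ReCh(N)`. -/
def retractsOfChains (N : MorphismProperty C) : MorphismProperty C :=
  commaRetracts (chains.{w} N)

/-- `Fc_κ(N)`: the class of all canonical morphisms `A ⟶ colim U_D`, where `D` is a (small)
`κ`-filtered subcategory of `A ↓ N` and `U_D : D ⥤ C` is the forgetful functor.
A subcategory is given by a faithful functor `F : D ⥤ A ↓ C` with values in `N`, so that one
morphism may be listed several times as an object of `D`.
The canonical morphism `f` is the common value of all composites
`A ⟶ U_D d ⟶ colim U_D`, for `d` in `D` (`D` is nonempty and connected, being `κ`-filtered). -/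
def filteredColimits (N : MorphismProperty C) (κ : Cardinal.{w}) [Fact κ.IsRegular] :
    MorphismProperty C :=
  fun A B f => ∃ (D : Type w) (_ : SmallCategory D) (_ : IsCardinalFiltered D κ)
    (F : D ⥤ Under A) (_ : F.Faithful) (_ : ∀ d : D, N (F.obj d).hom)
    (ι : F ⋙ Under.forget A ⟶ (Functor.const D).obj B),
      Nonempty (IsColimit (Cocone.mk B ι)) ∧ ∀ d : D, (F.obj d).hom ≫ ι.app d = f

end PresentableMorphisms

/-!
The argument rests on a description of the `κ`-presentable morphisms: they are the pushouts of
morphisms between `κ`-presentable objects (`presentableMorphisms.exists_isPushout`). Consequently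
there is only a set of them up to pushouts, and a `κ`-presentable morphism starting at a
`κ`-filtered colimit is a pushout of one which starts at a term of the diagram
(`presentableMorphisms.exists_isPushout_of_isColimit`). Classes of the form `P^▽` and `P^⊤`, where
`P` is any class of objects, are stable under pushouts, and conversely `f` belongs to such a class
as soon as `g` and the pushout of `f` along `g` do. So a member of `κ-P^▽` or `κ-P^⊤` starting at
the colimit of a `κ`-filtered diagram with coprojections in the larger class comes from a term of
the diagram.

For the orthogonal factorization of `f : A ⟶ B`, the factorizations `A ⟶ Y ⟶ B` of `f` with
`A ⟶ Y` in `κ-P^⊤` form an essentially small `κ`-filtered category, since `κ-P^⊤` is closed under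
`κ`-small colimits in `A ↓ C`. Let `X` be the colimit of the objects `Y`. To solve a lifting
problem for `X ⟶ B`, push it out to a member of `κ-P^⊤` starting at `X`, descend this to some `Y`,
and note that the resulting morphism `Y ⟶ Q` makes `Q` a further factorization of `f`, hence a term
of the diagram (`exists_factorization_filteredColimits`).

For the weak factorization, the step `f ↦ S f` glues to the source of `f` all pushouts in `κ-P^▽`
of morphisms from a representative set, one for each square to `f` (`exists_step`). It is a functor
because `P^▽` is stable under pushouts, and gluing a set of members at once is a transfinite
composition of pushouts of members (`transfiniteCompositions_of_wide_pushout`). Iterating it `κ`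
times (`exists_iteration`) and descending lifting problems to a stage of the iteration gives the
functorial factorization (`exists_functorial_factorization`); transfinite compositions of
transfinite compositions are again such (`transfiniteCompositions_of_transfiniteCompositions`).
The descent needs the coprojections of the iteration to be in `P^▽`; they have the left lifting
property with respect to everything on the right, in particular with respect to `K ⟶ ⊤_ C` for `K`
in `P` (`llp_rlp_presentableMembers_le`). The two classes then determine each other by the retract
argument.
-/

namespace PresentableMorphisms

variable {C : Type u} [Category.{v} C] {κ : Cardinal.{w}} [Fact κ.IsRegular]

/-! ### Presentable morphisms -/

section Factorization

variable {A B : C} {f : A ⟶ B} {J : Type w} [SmallCategory J] [IsCardinalFiltered J κ]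
  {F : J ⥤ C} {c : Cocone F}

/-- The natural transformation induced by `u : A ⟶ F.obj j` from the constant functor with value `A`
to the restriction of `F` to the objects under `j`. -/
@[simps]
def underTrans {j : J} (u : A ⟶ F.obj j) :
    (Functor.const (Under j)).obj A ⟶ Under.forget j ⋙ F where
  app x := u ≫ F.map x.hom
  naturality x y g := by
    have h : F.map y.hom = F.map x.hom ≫ F.map g.right := by rw [← F.map_comp, Under.w]
    simp [h]

/-- A square from a `κ`-presentable morphism `f` to a coprojection of a `κ`-filtered colimit in `C`
factors through a transition morphism of the diagram. -/
lemma presentableMorphisms.exists_factorization (hf : presentableMorphisms C κ f)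
    (hc : IsColimit c) {j : J} (u : A ⟶ F.obj j) (v : B ⟶ c.pt)
    (h : f ≫ v = u ≫ c.ι.app j) :
    ∃ (k : J) (a : j ⟶ k) (t : B ⟶ F.obj k), f ≫ t = u ≫ F.map a ∧ t ≫ c.ι.app k = v := by
  have := isFiltered_of_isCardinalFiltered J κ
  have : Nonempty (Under j) := ⟨Under.mk (𝟙 j)⟩
  have : IsCardinalPresentable (Under.mk f) κ := hf
  have hc' := Under.isColimitLiftCocone (Under.forget j ⋙ F) (underTrans u)
    (c.whisker (Under.forget j)) (f ≫ v) (fun x => by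
      simp [h]) ((Functor.Final.isColimitWhiskerEquiv (Under.forget j) c).symm hc)
  obtain ⟨k, q, hq⟩ := IsCardinalPresentable.exists_hom_of_isColimit κ hc'
    (Under.homMk (U := Under.mk f) (V := Under.mk (f ≫ v)) v rfl)
  exact ⟨k.right, k.hom, q.right, Under.w q, congr($(hq).right)⟩

/-- The factorizations of `presentableMorphisms.exists_factorization` are essentially unique. -/
lemma presentableMorphisms.exists_map_eq (hf : presentableMorphisms C κ f)
    (hc : IsColimit c) {j : J} (t₁ t₂ : B ⟶ F.obj j) (h : f ≫ t₁ = f ≫ t₂)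
    (h' : t₁ ≫ c.ι.app j = t₂ ≫ c.ι.app j) :
    ∃ (k : J) (a : j ⟶ k), t₁ ≫ F.map a = t₂ ≫ F.map a := by
  have := isFiltered_of_isCardinalFiltered J κ
  have : Nonempty (Under j) := ⟨Under.mk (𝟙 j)⟩
  have : IsCardinalPresentable (Under.mk f) κ := hf
  have hc' := Under.isColimitLiftCocone (Under.forget j ⋙ F) (underTrans (f ≫ t₁))
    (c.whisker (Under.forget j)) (f ≫ t₁ ≫ c.ι.app j) (fun x => by simp)
    ((Functor.Final.isColimitWhiskerEquiv (Under.forget j) c).symm hc)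
  let q₁ : Under.mk f ⟶ (Under.lift (Under.forget j ⋙ F) (underTrans (f ≫ t₁))).obj
    (Under.mk (𝟙 j)) := Under.homMk t₁ (by
    change f ≫ t₁ = (f ≫ t₁) ≫ F.map (𝟙 j)
    simp)
  let q₂ : Under.mk f ⟶ (Under.lift (Under.forget j ⋙ F) (underTrans (f ≫ t₁))).obj
    (Under.mk (𝟙 j)) := Under.homMk t₂ (by
    change f ≫ t₂ = (f ≫ t₁) ≫ F.map (𝟙 j)
    simp [h])
  obtain ⟨k, a, ha⟩ := IsCardinalPresentable.exists_eq_of_isColimit' κ hc' q₁ q₂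
    (by ext; exact h')
  exact ⟨k.right, a.right, congr($(ha).right)⟩

end Factorization

/-- Presentability of a morphism, tested on squares to a `κ`-filtered colimit in `C` itself
instead of on `κ`-filtered colimits in the comma category. -/
lemma presentableMorphisms_of_exists {A B : C} {f : A ⟶ B}
    (h₁ : ∀ (J : Type w) [SmallCategory J] [IsCardinalFiltered J κ] (F : J ⥤ C) (c : Cocone F)
      (_ : IsColimit c) (j : J) (u : A ⟶ F.obj j) (v : B ⟶ c.pt) (_ : f ≫ v = u ≫ c.ι.app j),
      ∃ (k : J) (a : j ⟶ k) (t : B ⟶ F.obj k), f ≫ t = u ≫ F.map a ∧ t ≫ c.ι.app k = v)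
    (h₂ : ∀ (J : Type w) [SmallCategory J] [IsCardinalFiltered J κ] (F : J ⥤ C) (c : Cocone F)
      (_ : IsColimit c) (j : J) (t₁ t₂ : B ⟶ F.obj j) (_ : f ≫ t₁ = f ≫ t₂)
      (_ : t₁ ≫ c.ι.app j = t₂ ≫ c.ι.app j),
      ∃ (k : J) (a : j ⟶ k), t₁ ≫ F.map a = t₂ ≫ F.map a) :
    presentableMorphisms C κ f where
  preservesColimitOfShape J _ _ := ⟨fun {G} => ⟨fun {c} hc => by
    have := isFiltered_of_isCardinalFiltered J κ
    have hc' := isColimitOfPreserves (Under.forget A) hc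
    refine ⟨Types.FilteredColimit.isColimitOf' _ _ (fun x => ?_) (fun i x y hxy => ?_)⟩
    · let x' : Under.mk f ⟶ c.pt := x
      obtain ⟨j⟩ := IsFiltered.nonempty (C := J)
      obtain ⟨k, a, t, ht, ht'⟩ := h₁ J _ _ hc' j (G.obj j).hom x'.right
        ((Under.w x').trans (Under.w (c.ι.app j)).symm)
      refine ⟨k, (Under.homMk t (ht.trans (Under.w (G.map a))) : Under.mk f ⟶ G.obj k), ?_⟩
      change x' = Under.homMk t _ ≫ c.ι.app k
      ext
      exact ht'.symm
    · let x' : Under.mk f ⟶ G.obj i := x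
      let y' : Under.mk f ⟶ G.obj i := y
      have hxy' : x' ≫ c.ι.app i = y' ≫ c.ι.app i := hxy
      obtain ⟨k, a, ha⟩ := h₂ J _ _ hc' i x'.right y'.right
        ((Under.w x').trans (Under.w y').symm) congr($(hxy').right)
      refine ⟨k, a, ?_⟩
      change x' ≫ G.map a = y' ≫ G.map a
      ext
      exact ha⟩⟩

lemma presentableMorphisms_of_isPushout {A B A' B' : C} {f : A ⟶ B} {g : A ⟶ A'} {f' : A' ⟶ B'}
    {g' : B ⟶ B'} (sq : IsPushout g f f' g') (hf : presentableMorphisms C κ f) :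
    presentableMorphisms C κ f' := by
  refine presentableMorphisms_of_exists ?_ ?_
  · intro J _ _ F c hc j u v h
    obtain ⟨k, a, t, ht, ht'⟩ := hf.exists_factorization hc (g ≫ u) (g' ≫ v) (by
      rw [← sq.w_assoc, h, Category.assoc])
    refine ⟨k, a, sq.desc (u ≫ F.map a) t (by rw [ht, Category.assoc]), by simp, ?_⟩
    apply sq.hom_ext
    · simp [h]
    · simp [ht']
  · intro J _ _ F c hc j t₁ t₂ h h'
    obtain ⟨k, a, ha⟩ := hf.exists_map_eq hc (g' ≫ t₁) (g' ≫ t₂) (by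
      rw [← sq.w_assoc, ← sq.w_assoc, h]) (by simp [h'])
    refine ⟨k, a, sq.hom_ext ?_ ?_⟩
    · rw [reassoc_of% h]
    · simpa using ha

lemma presentableMorphisms_comp {X Y Z : C} {f : X ⟶ Y} {g : Y ⟶ Z}
    (hf : presentableMorphisms C κ f) (hg : presentableMorphisms C κ g) :
    presentableMorphisms C κ (f ≫ g) := by
  refine presentableMorphisms_of_exists ?_ ?_
  · intro J _ _ F c hc j u v h
    obtain ⟨k, a, t, ht, ht'⟩ := hf.exists_factorization hc u (g ≫ v) (by simpa using h)
    obtain ⟨l, b, s, hs, hs'⟩ := hg.exists_factorization hc t v ht'.symm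
    exact ⟨l, a ≫ b, s, by rw [Category.assoc, hs, reassoc_of% ht, F.map_comp], hs'⟩
  · intro J _ _ F c hc j t₁ t₂ h h'
    obtain ⟨k, a, ha⟩ := hf.exists_map_eq hc (g ≫ t₁) (g ≫ t₂) (by simpa using h) (by simp [h'])
    obtain ⟨l, b, hb⟩ := hg.exists_map_eq hc (t₁ ≫ F.map a) (t₂ ≫ F.map a) (by simpa using ha)
      (by simpa using h')
    exact ⟨l, a ≫ b, by simpa using hb⟩

lemma presentableMorphisms_of_isCardinalPresentable {X Y : C} (f : X ⟶ Y)
    [IsCardinalPresentable X κ] [IsCardinalPresentable Y κ] : presentableMorphisms C κ f := by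
  refine presentableMorphisms_of_exists ?_ ?_
  · intro J _ _ F c hc j u v h
    obtain ⟨i, t, ht⟩ := IsCardinalPresentable.exists_hom_of_isColimit κ hc v
    obtain ⟨k, a, b, hab⟩ := IsCardinalPresentable.exists_eq_of_isColimit κ hc (f ≫ t) u
      (by rw [Category.assoc, ht, h])
    exact ⟨k, b, t ≫ F.map a, by simpa using hab, by simpa using ht⟩
  · intro J _ _ F c hc j t₁ t₂ h h'
    exact IsCardinalPresentable.exists_eq_of_isColimit' κ hc t₁ t₂ h'

lemma presentableMorphisms_of_isIso {X Y : C} (f : X ⟶ Y) [IsIso f] :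
    presentableMorphisms C κ f := by
  refine presentableMorphisms_of_exists ?_ ?_
  · intro J _ _ F c hc j u v h
    exact ⟨j, 𝟙 j, inv f ≫ u, by simp, by simp [← h]⟩
  · intro J _ _ F c hc j t₁ t₂ h h'
    exact ⟨j, 𝟙 j, by rw [(cancel_epi f).1 h]⟩

lemma isCardinalPresentable_of_initial [HasInitial C] {X : C} (f : ⊥_ C ⟶ X)
    (hf : presentableMorphisms C κ f) : IsCardinalPresentable X κ where
  preservesColimitOfShape J _ _ := ⟨fun {G} => ⟨fun {c} hc => by
    have := isFiltered_of_isCardinalFiltered J κ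
    refine ⟨Types.FilteredColimit.isColimitOf' _ _ (fun x => ?_) (fun i x y hxy => ?_)⟩
    · obtain ⟨j⟩ := IsFiltered.nonempty (C := J)
      obtain ⟨k, a, t, ht, ht'⟩ := hf.exists_factorization hc (j := j) (initial.to _) x
        (initial.hom_ext _ _)
      exact ⟨k, t, ht'.symm⟩
    · exact hf.exists_map_eq hc x y (initial.hom_ext _ _) hxy⟩⟩

/-! ### Arrows as filtered colimits of arrows between presentable objects -/

instance [LocallySmall.{w} C] : LocallySmall.{w} (Arrow C) where
  hom_small f g := small_of_injective (β := (f.left ⟶ g.left) × (f.right ⟶ g.right))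
    (f := fun φ => (φ.left, φ.right)) (fun φ ψ h => by
      ext
      · exact congrArg Prod.fst h
      · exact congrArg Prod.snd h)

instance [HasColimitsOfSize.{w, w} C] : HasColimitsOfSize.{w, w} (Arrow C) where
  has_colimits_of_shape _ _ := inferInstance

variable (C κ) in
/-- The morphisms between `κ`-presentable objects, as objects of the category of arrows. -/
def presentableArrows : ObjectProperty (Arrow C) :=
  fun p => isCardinalPresentable C κ p.left ∧ isCardinalPresentable C κ p.right

variable (C κ) in
lemma presentableArrows_le [HasColimitsOfSize.{w, w} C] :
    presentableArrows C κ ≤ isCardinalPresentable (Arrow C) κ := by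
  rintro p ⟨hl, hr⟩
  rw [isCardinalPresentable_iff] at hl hr
  refine ⟨fun J _ _ => ⟨fun {G} => ⟨fun {c} hc => ?_⟩⟩⟩
  have := isFiltered_of_isCardinalFiltered J κ
  have hcl := isColimitOfPreserves Arrow.leftFunc hc
  have hcr := isColimitOfPreserves Arrow.rightFunc hc
  refine ⟨Types.FilteredColimit.isColimitOf' _ _ (fun x => ?_) (fun i x y hxy => ?_)⟩
  · let x' : p ⟶ c.pt := x
    obtain ⟨j, s, hs⟩ : ∃ (j : J) (s : p.left ⟶ (G.obj j).left),
        s ≫ (c.ι.app j).left = x'.left :=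
      IsCardinalPresentable.exists_hom_of_isColimit κ hcl x'.left
    have hp := presentableMorphisms_of_isCardinalPresentable (κ := κ) p.hom
    obtain ⟨k, a, t, ht, ht'⟩ : ∃ (k : J) (a : j ⟶ k) (t : p.right ⟶ (G.obj k).right),
        p.hom ≫ t = (s ≫ (G.obj j).hom) ≫ (G.map a).right ∧
        t ≫ (c.ι.app k).right = x'.right :=
      hp.exists_factorization hcr (j := j) (s ≫ (G.obj j).hom) x'.right (by
        have h : (c.ι.app j).left ≫ c.pt.hom = (G.obj j).hom ≫ (c.ι.app j).right :=
          Arrow.w (c.ι.app j)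
        have h' : x'.left ≫ c.pt.hom = p.hom ≫ x'.right := Arrow.w x'
        change p.hom ≫ x'.right = (s ≫ (G.obj j).hom) ≫ (c.ι.app j).right
        rw [Category.assoc, ← h, reassoc_of% hs, h'])
    have hw : (G.map a).left ≫ (G.obj k).hom = (G.obj j).hom ≫ (G.map a).right := by
      rw [Arrow.w]
    refine ⟨k, (Arrow.homMk (s ≫ (G.map a).left) t (by
      rw [Category.assoc, hw, ht, Category.assoc]) : p ⟶ G.obj k), ?_⟩
    change x' = Arrow.homMk _ _ _ ≫ c.ι.app k
    ext
    · have h : (G.map a).left ≫ (c.ι.app k).left = (c.ι.app j).left := congr($(c.w a).left)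
      change x'.left = (s ≫ (G.map a).left) ≫ (c.ι.app k).left
      rw [Category.assoc, h, hs]
    · exact ht'.symm
  · let x' : p ⟶ G.obj i := x
    let y' : p ⟶ G.obj i := y
    have hxy' : x' ≫ c.ι.app i = y' ≫ c.ι.app i := hxy
    obtain ⟨j, a, ha⟩ : ∃ (j : J) (a : i ⟶ j),
        x'.left ≫ (G.map a).left = y'.left ≫ (G.map a).left :=
      IsCardinalPresentable.exists_eq_of_isColimit' κ hcl x'.left y'.left
        congr($(hxy').left)
    obtain ⟨k, b, hb⟩ : ∃ (k : J) (b : j ⟶ k), (x'.right ≫ (G.map a).right) ≫ (G.map b).right =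
        (y'.right ≫ (G.map a).right) ≫ (G.map b).right :=
      IsCardinalPresentable.exists_eq_of_isColimit' κ hcr
      (x'.right ≫ (G.map a).right) (y'.right ≫ (G.map a).right) (by
        have h : (G.map a).right ≫ (c.ι.app j).right = (c.ι.app i).right := congr($(c.w a).right)
        have h' : x'.right ≫ (c.ι.app i).right = y'.right ≫ (c.ι.app i).right :=
          congr($(hxy').right)
        change (x'.right ≫ (G.map a).right) ≫ (c.ι.app j).right =
          (y'.right ≫ (G.map a).right) ≫ (c.ι.app j).right
        rw [Category.assoc, Category.assoc, h, h'])
    refine ⟨k, a ≫ b, ?_⟩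
    change x' ≫ G.map (a ≫ b) = y' ≫ G.map (a ≫ b)
    ext
    · simp only [Functor.map_comp, Arrow.comp_left]
      rw [reassoc_of% ha]
    · simpa using hb

instance isClosedUnderIsomorphisms_presentableArrows :
    (presentableArrows C κ).IsClosedUnderIsomorphisms where
  of_iso e h := ⟨(isCardinalPresentable C κ).prop_of_iso (Arrow.leftFunc.mapIso e) h.1,
    (isCardinalPresentable C κ).prop_of_iso (Arrow.rightFunc.mapIso e) h.2⟩

lemma isClosedUnderColimitsOfShape_presentableArrows [LocallySmall.{w} C]
    [HasColimitsOfSize.{w, w} C] (J : Type w) [SmallCategory J] (hJ : HasCardinalLT (Arrow J) κ) :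
    (presentableArrows C κ).IsClosedUnderColimitsOfShape J where
  colimitsOfShape_le := by
    rintro X ⟨hX⟩
    have := isClosedUnderColimitsOfShape_isCardinalPresentable C hJ
    exact ⟨(isCardinalPresentable C κ).prop_of_isColimit
      (isColimitOfPreserves Arrow.leftFunc hX.isColimit) (fun j => (hX.prop_diag_obj j).1),
      (isCardinalPresentable C κ).prop_of_isColimit
      (isColimitOfPreserves Arrow.rightFunc hX.isColimit) (fun j => (hX.prop_diag_obj j).2)⟩

/-- If the objects `G` with `S G` form a strong generator of `C`, then the morphisms `⊥ ⟶ G`, which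
test the target of an arrow, and `𝟙 G`, which test its source, form one of the category of
arrows. -/
lemma isStrongGenerator_arrow [HasInitial C] {S : ObjectProperty C} (hS : S.IsStrongGenerator)
    {P : ObjectProperty (Arrow C)} (hP₁ : ∀ G, S G → P (Arrow.mk (initial.to G)))
    (hP₂ : ∀ G, S G → P (Arrow.mk (𝟙 G))) : P.IsStrongGenerator := by
  rw [ObjectProperty.isStrongGenerator_iff]
  let fromInit (G : C) (q : Arrow C) (t : G ⟶ q.right) : Arrow.mk (initial.to G) ⟶ q :=
    Arrow.homMk (initial.to q.left) t (initial.hom_ext _ _)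
  let fromId (G : C) (q : Arrow C) (s : G ⟶ q.left) : Arrow.mk (𝟙 G) ⟶ q :=
    Arrow.homMk s (s ≫ q.hom) (by simp)
  refine ⟨fun p q x y h => ?_, fun p q i _ hi => ?_⟩
  · ext
    · refine hS.isSeparating _ _ (fun G hG g => ?_)
      exact congr($(h _ (hP₂ G hG) (fromId G p g)).left)
    · refine hS.isSeparating _ _ (fun G hG g => ?_)
      exact congr($(h _ (hP₁ G hG) (fromInit G p g)).right)
  · have hl : IsIso i.left := by
      have : Mono i.left := by
        rw [hS.isSeparating.mono_iff]
        intro G hG g₁ g₂ hg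
        have : fromId G p g₁ = fromId G p g₂ := by
          rw [← cancel_mono i]
          ext
          · exact hg
          · have h : i.left ≫ q.hom = p.hom ≫ i.right := Arrow.w i
            change (g₁ ≫ p.hom) ≫ i.right = (g₂ ≫ p.hom) ≫ i.right
            rw [Category.assoc, Category.assoc, ← h, reassoc_of% hg]
        exact congr($(this).left)
      refine hS.isIso_of_mono _ (fun G hG g => ?_)
      obtain ⟨t, ht⟩ := hi _ (hP₂ G hG) (fromId G q g)
      exact ⟨t.left, congr($(ht).left)⟩
    have hr : IsIso i.right := by
      have : Mono i.right := by
        rw [hS.isSeparating.mono_iff]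
        intro G hG g₁ g₂ hg
        have : fromInit G p g₁ = fromInit G p g₂ := by
          rw [← cancel_mono i]
          ext
          · exact initial.hom_ext _ _
          · exact hg
        exact congr($(this).right)
      refine hS.isIso_of_mono _ (fun G hG g => ?_)
      obtain ⟨t, ht⟩ := hi _ (hP₁ G hG) (fromInit G q g)
      exact ⟨t.right, congr($(ht).right)⟩
    exact Arrow.isIso_of_isIso_left_of_isIso_right i

/-- In a locally `κ`-presentable category the arrows between `κ`-presentable objects contain a
strong generator of `Arrow C` and are closed under `κ`-small colimits, hence every arrow is a
`κ`-filtered colimit of them. -/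
lemma exists_colimitOfShape_presentableArrows [IsCardinalLocallyPresentable C κ] (p : Arrow C) :
    ∃ (J : Type w) (_ : SmallCategory J) (_ : IsCardinalFiltered J κ),
      Nonempty ((presentableArrows C κ).ColimitOfShape J p) := by
  obtain ⟨S, _, hS⟩ := HasCardinalFilteredGenerator.exists_small_generator C κ
  let X : Subtype S ⊕ Subtype S → Arrow C := Sum.elim (fun G => Arrow.mk (initial.to G.1))
    (fun G => Arrow.mk (𝟙 G.1))
  let P := ObjectProperty.ofObj X
  have hS₁ : P.IsStrongGenerator := isStrongGenerator_arrow hS.isStrongGenerator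
    (fun G hG => ObjectProperty.ofObj_apply X (Sum.inl ⟨G, hG⟩))
    (fun G hG => ObjectProperty.ofObj_apply X (Sum.inr ⟨G, hG⟩))
  have hinit : isCardinalPresentable C κ (⊥_ C) :=
    isCardinalPresentable_of_initial (𝟙 _) (presentableMorphisms_of_isIso _)
  have hP : P ≤ presentableArrows C κ := by
    rintro _ ⟨G | G⟩
    · exact ⟨hinit, hS.le_isCardinalPresentable _ G.2⟩
    · exact ⟨hS.le_isCardinalPresentable _ G.2, hS.le_isCardinalPresentable _ G.2⟩
  have hP' := hP.trans (presentableArrows_le C κ)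
  have : ObjectProperty.Small.{w} P := by dsimp [P]; infer_instance
  have := hS₁.isDense_colimitsCardinalClosure_ι hP'
  have hgen := IsCardinalFilteredGenerator.of_isDense_ι (P.colimitsCardinalClosure κ) κ
    (P.colimitsCardinalClosure_le_isCardinalPresentable hP')
  obtain ⟨J, _, _, hJ⟩ := hgen.exists_colimitsOfShape p
  refine ⟨J, inferInstance, inferInstance, ?_⟩
  exact ObjectProperty.colimitsOfShape_monotone J (P.colimitsCardinalClosure_le κ
    (fun J _ hJ => isClosedUnderColimitsOfShape_presentableArrows J hJ) hP) _ hJ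

/-! ### Presentable morphisms as pushouts -/

lemma hasCardinalLT_arrow_of_finCategory (κ : Cardinal.{w}) [Fact κ.IsRegular] (J : Type*)
    [Category J] [Finite (Arrow J)] : HasCardinalLT (Arrow J) κ :=
  HasCardinalLT.of_le (by rwa [hasCardinalLT_aleph0_iff]) (Cardinal.IsRegular.aleph0_le Fact.out)

instance isCardinalPresentable_pushout [LocallySmall.{w} C] {X Y Z : C} (f : X ⟶ Y) (g : X ⟶ Z)
    [HasPushout f g] [IsCardinalPresentable X κ] [IsCardinalPresentable Y κ]
    [IsCardinalPresentable Z κ] : IsCardinalPresentable (pushout f g) κ := by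
  have := isClosedUnderColimitsOfShape_isCardinalPresentable C
    (hasCardinalLT_arrow_of_finCategory κ WalkingSpan)
  apply (isCardinalPresentable C κ).prop_colimit
  rintro (_ | _ | _) <;> assumption

instance isCardinalPresentable_coequalizer [LocallySmall.{w} C] {X Y : C} (f g : X ⟶ Y)
    [HasCoequalizer f g] [IsCardinalPresentable X κ] [IsCardinalPresentable Y κ] :
    IsCardinalPresentable (coequalizer f g) κ := by
  have := isClosedUnderColimitsOfShape_isCardinalPresentable C
    (hasCardinalLT_arrow_of_finCategory κ WalkingParallelPair)
  apply (isCardinalPresentable C κ).prop_colimit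
  rintro (_ | _) <;> assumption

/-- Pushouts commute with colimits. -/
lemma exists_isColimit_pushout [HasPushouts C] {J : Type*} [Category J] {F G H : J ⥤ C}
    (p : F ⟶ G) (q : F ⟶ H) {cF : Cocone F} {cG : Cocone G} {cH : Cocone H} {Q : C}
    {f : cF.pt ⟶ cG.pt} {g : cF.pt ⟶ cH.pt} {i : cG.pt ⟶ Q} {j : cH.pt ⟶ Q}
    (hF : IsColimit cF) (hG : IsColimit cG) (hH : IsColimit cH) (sq : IsPushout f g i j)
    (hf : ∀ k, cF.ι.app k ≫ f = p.app k ≫ cG.ι.app k)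
    (hg : ∀ k, cF.ι.app k ≫ g = q.app k ≫ cH.ι.app k) :
    ∃ (P : J ⥤ C) (inl : G ⟶ P) (inr : H ⟶ P) (π : P ⟶ (Functor.const J).obj Q),
      Nonempty (IsColimit (Cocone.mk Q π)) ∧
      (∀ k, IsPushout (p.app k) (q.app k) (inl.app k) (inr.app k)) ∧
      (∀ k, inl.app k ≫ π.app k = cG.ι.app k ≫ i) ∧
      (∀ k, inr.app k ≫ π.app k = cH.ι.app k ≫ j) := by
  have sqP := IsPushout.of_hasPushout p q
  have hP (k : J) : IsPushout (p.app k) (q.app k) ((pushout.inl p q).app k)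
      ((pushout.inr p q).app k) := sqP.map ((evaluation J C).obj k)
  obtain ⟨π, hl, hr⟩ : ∃ (π : pushout p q ⟶ (Functor.const J).obj Q),
      (∀ k, (pushout.inl p q).app k ≫ π.app k = cG.ι.app k ≫ i) ∧
      (∀ k, (pushout.inr p q).app k ≫ π.app k = cH.ι.app k ≫ j) := by
    have w : p ≫ cG.ι ≫ (Functor.const J).map i = q ≫ cH.ι ≫ (Functor.const J).map j := by
      ext k
      have h₁ := hf k
      have h₂ := hg k
      change p.app k ≫ cG.ι.app k ≫ i = q.app k ≫ cH.ι.app k ≫ j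
      rw [← reassoc_of% h₁, ← reassoc_of% h₂, sq.w]
    exact ⟨pushout.desc (cG.ι ≫ (Functor.const J).map i) (cH.ι ≫ (Functor.const J).map j) w,
      fun k => NatTrans.congr_app (pushout.inl_desc _ _ w) k,
      fun k => NatTrans.congr_app (pushout.inr_desc _ _ w) k⟩
  refine ⟨pushout p q, pushout.inl p q, pushout.inr p q, π,
    ⟨IsColimit.ofExistsUnique (fun s => ?_)⟩, hP, hl, hr⟩
  have h : f ≫ hG.desc (Cocone.mk s.pt (pushout.inl p q ≫ s.ι)) =
      g ≫ hH.desc (Cocone.mk s.pt (pushout.inr p q ≫ s.ι)) := by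
    refine hF.hom_ext (fun k => ?_)
    have h₁ := hf k
    have h₂ := hg k
    dsimp at h₁ h₂ ⊢
    rw [reassoc_of% h₁, reassoc_of% h₂, hG.fac, hH.fac]
    exact (hP k).w_assoc _
  refine ⟨sq.desc _ _ h, fun k => ?_, fun m hm => ?_⟩
  · apply (hP k).hom_ext
    · rw [← Category.assoc]
      change ((pushout.inl p q).app k ≫ π.app k) ≫ _ = _
      rw [hl, Category.assoc, sq.inl_desc, hG.fac]
      rfl
    · rw [← Category.assoc]
      change ((pushout.inr p q).app k ≫ π.app k) ≫ _ = _
      rw [hr, Category.assoc, sq.inr_desc, hH.fac]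
      rfl
  · apply sq.hom_ext
    · refine hG.hom_ext (fun k => ?_)
      rw [sq.inl_desc, hG.fac, ← Category.assoc, ← hl, Category.assoc]
      exact congr((pushout.inl p q).app k ≫ $(hm k))
    · refine hH.hom_ext (fun k => ?_)
      rw [sq.inr_desc, hH.fac, ← Category.assoc, ← hr, Category.assoc]
      exact congr((pushout.inr p q).app k ≫ $(hm k))

lemma isPushout_of_existsUnique {X Y Z Q : C} {f : X ⟶ Y} {g : X ⟶ Z} {i : Y ⟶ Q} {j : Z ⟶ Q}
    (w : f ≫ i = g ≫ j) (h : ∀ ⦃T : C⦄ (u : Y ⟶ T) (v : Z ⟶ T), f ≫ u = g ≫ v →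
      ∃! d : Q ⟶ T, i ≫ d = u ∧ j ≫ d = v) : IsPushout f g i j := by
  choose d hd hd' using h
  exact ⟨⟨w⟩, ⟨PushoutCocone.IsColimit.mk w (fun s => d _ _ s.condition)
    (fun s => (hd _ _ s.condition).1) (fun s => (hd _ _ s.condition).2)
    (fun s m h₁ h₂ => hd' _ _ s.condition _ ⟨h₁, h₂⟩)⟩⟩

/-- Every morphism is a `κ`-filtered colimit of morphisms between `κ`-presentable objects. -/
lemma exists_isColimit_arrow [IsCardinalLocallyPresentable C κ] {A B : C} (f : A ⟶ B) :
    ∃ (J : Type w) (_ : SmallCategory J) (_ : IsCardinalFiltered J κ) (a b : J ⥤ C) (p : a ⟶ b)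
      (α : a ⟶ (Functor.const J).obj A) (β : b ⟶ (Functor.const J).obj B),
      Nonempty (IsColimit (Cocone.mk A α)) ∧ Nonempty (IsColimit (Cocone.mk B β)) ∧
      (∀ j, (α.app j ≫ f : a.obj j ⟶ B) = p.app j ≫ β.app j) ∧
      (∀ j, IsCardinalPresentable (a.obj j) κ) ∧ ∀ j, IsCardinalPresentable (b.obj j) κ := by
  obtain ⟨J, _, _, ⟨pres⟩⟩ := exists_colimitOfShape_presentableArrows (κ := κ) (Arrow.mk f)
  have := isFiltered_of_isCardinalFiltered J κ
  exact ⟨J, inferInstance, inferInstance, pres.diag ⋙ Arrow.leftFunc, pres.diag ⋙ Arrow.rightFunc,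
    Functor.whiskerLeft pres.diag Arrow.leftToRight,
    Functor.whiskerRight pres.ι Arrow.leftFunc, Functor.whiskerRight pres.ι Arrow.rightFunc,
    ⟨isColimitOfPreserves Arrow.leftFunc pres.isColimit⟩,
    ⟨isColimitOfPreserves Arrow.rightFunc pres.isColimit⟩,
    fun j => Arrow.w (pres.ι.app j), fun j => (pres.prop_diag_obj j).1,
    fun j => (pres.prop_diag_obj j).2⟩

/-- Every `κ`-presentable morphism is a pushout of a morphism between `κ`-presentable objects.
Write `f : A ⟶ B` as a `κ`-filtered colimit of morphisms `p j : a j ⟶ b j` between `κ`-presentable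
objects. Then `f` is also the colimit of the pushouts `A ⟶ F j` of the `p j`, hence a retract of
one of them, say with retraction `r : F i ⟶ B` and section `s`. Since `F i` is the colimit of the
pushouts `q k` of `p i` along `a i ⟶ a k`, the idempotent `r ≫ s` is induced by an endomorphism `e`
of some `q k` under `a k`, and `f` is a pushout of `a k ⟶ coequalizer e (𝟙 _)`. -/
lemma presentableMorphisms.exists_isPushout [IsCardinalLocallyPresentable C κ] {A B : C}
    {f : A ⟶ B} (hf : presentableMorphisms C κ f) :
    ∃ (a b : C) (g : a ⟶ b) (x : a ⟶ A) (y : b ⟶ B), IsCardinalPresentable a κ ∧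
      IsCardinalPresentable b κ ∧ IsPushout x g f y := by
  obtain ⟨J, _, _, a, b, p, α, β, ⟨hA⟩, ⟨hB⟩, hw, ha, hb⟩ := exists_isColimit_arrow (κ := κ) f
  have := isFiltered_of_isCardinalFiltered J κ
  have := IsFiltered.isConnected J
  obtain ⟨F, inl, inr, π, ⟨hπ⟩, sq, hl, hr, hinr⟩ : ∃ (F : J ⥤ C) (inl : ∀ k, b.obj k ⟶ F.obj k)
      (inr : ∀ k, A ⟶ F.obj k) (π : F ⟶ (Functor.const J).obj B),
      Nonempty (IsColimit (Cocone.mk B π)) ∧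
      (∀ k, IsPushout (p.app k) (α.app k : a.obj k ⟶ A) (inl k) (inr k)) ∧
      (∀ k, (inl k ≫ π.app k : b.obj k ⟶ B) = β.app k) ∧
      (∀ k, (inr k ≫ π.app k : A ⟶ B) = f) ∧
      (∀ k l (g : k ⟶ l), inr k ≫ F.map g = inr l) := by
    obtain ⟨F, inl, inr, π, hπ, sq, hl, hr⟩ := exists_isColimit_pushout p α hA hB
      (isColimitConstCocone J A) (IsPushout.of_id_snd (f := f)) hw
      (fun k => by simp [constCocone])
    refine ⟨F, inl.app, inr.app, π, hπ, sq, fun k => (hl k).trans (Category.comp_id _),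
      fun k => (hr k).trans (Category.id_comp _), fun k l g => ?_⟩
    exact (inr.naturality g).symm.trans (Category.id_comp _)
  -- `F` is a `κ`-filtered diagram under `A` with colimit `f`, so the identity of `f` factors
  -- through one of its terms.
  obtain ⟨j₀⟩ := IsFiltered.nonempty (C := J)
  obtain ⟨i, a₀, s, hs, hs'⟩ : ∃ (i : J) (a₀ : j₀ ⟶ i) (s : B ⟶ F.obj i),
      f ≫ s = inr j₀ ≫ F.map a₀ ∧ (s ≫ π.app i : B ⟶ B) = 𝟙 B :=
    hf.exists_factorization hπ (inr j₀) (𝟙 B) ((Category.comp_id _).trans (hr j₀).symm)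
  rw [hinr] at hs
  obtain ⟨r, hrdef⟩ : ∃ r : F.obj i ⟶ B, r = π.app i := ⟨_, rfl⟩
  have hs'' : s ≫ r = 𝟙 B := by rw [hrdef]; exact hs'
  have hlr : inr i ≫ r = f := by rw [hrdef]; exact hr i
  obtain ⟨x, hx⟩ : ∃ x : a.obj i ⟶ A, x = α.app i := ⟨_, rfl⟩
  have sqi : IsPushout (p.app i) x (inl i) (inr i) := by rw [hx]; exact sq i
  have hai := ha i
  have hbi := hb i
  have : Nonempty (Under i) := ⟨Under.mk (𝟙 i)⟩
  have := IsFiltered.isConnected (Under i)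
  obtain ⟨q, inl', inr', ρ, ⟨hρ⟩, sq', hl', hr', hinl', hinr'⟩ : ∃ (q : Under i ⥤ C)
      (inl' : ∀ k, b.obj i ⟶ q.obj k) (inr' : ∀ k : Under i, a.obj k.right ⟶ q.obj k)
      (ρ : q ⟶ (Functor.const (Under i)).obj (F.obj i)),
      Nonempty (IsColimit (Cocone.mk (F.obj i) ρ)) ∧
      (∀ k : Under i, IsPushout (p.app i) (a.map k.hom) (inl' k) (inr' k)) ∧
      (∀ k, (inl' k ≫ ρ.app k : b.obj i ⟶ F.obj i) = inl i) ∧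
      (∀ k : Under i, (inr' k ≫ ρ.app k : a.obj k.right ⟶ F.obj i) = α.app k.right ≫ inr i) ∧
      (∀ k l (g : k ⟶ l), inl' k ≫ q.map g = inl' l) ∧
      (∀ (k l : Under i) (g : k ⟶ l), inr' k ≫ q.map g = a.map g.right ≫ inr' l) := by
    obtain ⟨q, inl', inr', ρ, hρ, sq', hl', hr'⟩ := exists_isColimit_pushout
      (J := Under i)
      ((Functor.const (Under i)).map (p.app i)) (underTrans (F := a) (𝟙 (a.obj i)))
      (isColimitConstCocone (Under i) (a.obj i)) (isColimitConstCocone (Under i) (b.obj i))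
      ((Functor.Final.isColimitWhiskerEquiv (Under.forget i) _).symm hA)
      (f := p.app i) (g := x) (i := inl i) (j := inr i) sqi
      (fun k => (Category.id_comp _).trans (Category.comp_id _).symm)
      (fun k => by
        have h : a.map k.hom ≫ α.app k.right = α.app i := (α.naturality k.hom).trans
          (Category.comp_id _)
        have h' : (𝟙 (a.obj i) ≫ a.map k.hom) ≫ α.app k.right = x := by
          rw [hx, Category.id_comp, h]
        exact (Category.id_comp _).trans h'.symm)
    refine ⟨q, inl'.app, inr'.app, ρ, hρ, fun k => ?_, fun k => (hl' k).trans (Category.id_comp _),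
      fun k => hr' k, fun k l g => ?_, fun k l g => ?_⟩
    · have h := sq' k
      have h' : (underTrans (F := a) (𝟙 (a.obj i))).app k = a.map k.hom := Category.id_comp _
      rw [h'] at h
      exact h
    · exact (inl'.naturality g).symm.trans (Category.id_comp _)
    · exact (inr'.naturality g).symm
  -- The idempotent `r ≫ s` of `F.obj i` is induced by an endomorphism of some `q.obj k`.
  obtain ⟨k, t, ht, ht'⟩ : ∃ (k : Under i) (t : b.obj i ⟶ q.obj k),
      t ≫ ρ.app k = inl i ≫ r ≫ s ∧ p.app i ≫ t = a.map k.hom ≫ inr' k := by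
    obtain ⟨k₀, t₀, ht₀⟩ : ∃ (k₀ : Under i) (t₀ : b.obj i ⟶ q.obj k₀),
      (t₀ ≫ ρ.app k₀ : b.obj i ⟶ F.obj i) = inl i ≫ r ≫ s :=
      IsCardinalPresentable.exists_hom_of_isColimit κ hρ (inl i ≫ r ≫ s)
    have h : a.map k₀.hom ≫ α.app k₀.right = α.app i := (α.naturality k₀.hom).trans
      (Category.comp_id _)
    obtain ⟨k, g, hg⟩ := IsCardinalPresentable.exists_eq_of_isColimit' κ hρ
      (p.app i ≫ t₀) (a.map k₀.hom ≫ inr' k₀) (by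
        refine (Category.assoc _ _ _).trans (Eq.trans ?_ (Category.assoc _ _ _).symm)
        refine (congr(p.app i ≫ $ht₀)).trans (Eq.trans ?_ (congr(a.map k₀.hom ≫ $(hr' k₀))).symm)
        have h' : a.map k₀.hom ≫ α.app k₀.right ≫ inr i = x ≫ inr i := by
          rw [← Category.assoc, hx]
          exact congr($h ≫ inr i)
        refine Eq.trans ?_ h'.symm
        rw [sqi.w_assoc, reassoc_of% hlr, hs])
    refine ⟨k, t₀ ≫ q.map g, ?_, ?_⟩
    · rw [Category.assoc, ρ.naturality g]
      exact (congr(t₀ ≫ $(Category.comp_id (ρ.app k₀)))).trans ht₀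
    · rw [← Category.assoc, hg, Category.assoc, hinr', ← Category.assoc, ← a.map_comp]
      exact congr(a.map $(Under.w g) ≫ inr' k)
  obtain ⟨L, hL⟩ : ∃ L : q.obj k ⟶ F.obj i, L = ρ.app k := ⟨_, rfl⟩
  obtain ⟨z, hz⟩ : ∃ z : a.obj k.right ⟶ A, z = α.app k.right := ⟨_, rfl⟩
  have hlL : inl' k ≫ L = inl i := by rw [hL]; exact hl' k
  have hrL : inr' k ≫ L = z ≫ inr i := by rw [hL, hz]; exact hr' k
  have htL : t ≫ L = inl i ≫ r ≫ s := by rw [hL]; exact ht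
  have hxz : a.map k.hom ≫ z = x := by
    rw [hz, hx]; exact (α.naturality k.hom).trans (Category.comp_id _)
  have sqk := sq' k
  have hak := ha k.right
  have hqk : IsCardinalPresentable (q.obj k) κ :=
    (isCardinalPresentable C κ).prop_of_iso sqk.isoPushout.symm
      (isCardinalPresentable_pushout (p.app i) (a.map k.hom))
  let e : q.obj k ⟶ q.obj k := sqk.desc t (inr' k) ht'
  have heL : e ≫ L = L ≫ r ≫ s := by
    apply sqk.hom_ext
    · rw [sqk.inl_desc_assoc, htL, reassoc_of% hlL]
    · rw [sqk.inr_desc_assoc, reassoc_of% hrL, hrL, reassoc_of% hlr, hs]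
  let c : q.obj k ⟶ coequalizer e (𝟙 _) := coequalizer.π e (𝟙 _)
  have hc : e ≫ c = c := by simpa using coequalizer.condition e (𝟙 _)
  let y : coequalizer e (𝟙 _) ⟶ B := coequalizer.desc (L ≫ r) (by
    rw [reassoc_of% heL, hs'', Category.comp_id, Category.id_comp])
  have hy : c ≫ y = L ≫ r := coequalizer.π_desc _ _
  refine ⟨a.obj k.right, coequalizer e (𝟙 _), inr' k ≫ c, z, y, hak, inferInstance,
    isPushout_of_existsUnique ?_ (fun T u v huv => ?_)⟩
  · rw [Category.assoc, hy, reassoc_of% hrL, hlr]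
  · rw [Category.assoc] at huv
    have hd : p.app i ≫ inl' k ≫ c ≫ v = x ≫ u := by
      rw [sqk.w_assoc, ← huv, reassoc_of% hxz]
    have hLd : L ≫ sqi.desc _ _ hd = c ≫ v := by
      apply sqk.hom_ext
      · rw [reassoc_of% hlL, sqi.inl_desc]
      · rw [reassoc_of% hrL, sqi.inr_desc, huv]
    refine ⟨s ≫ sqi.desc _ _ hd, ⟨by rw [reassoc_of% hs, sqi.inr_desc], ?_⟩, ?_⟩
    · apply coequalizer.hom_ext
      change c ≫ y ≫ _ = c ≫ v
      rw [reassoc_of% hy, ← reassoc_of% heL, hLd, reassoc_of% hc]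
    · rintro m ⟨hm, hm'⟩
      have : r ≫ m = sqi.desc _ _ hd := by
        apply sqi.hom_ext
        · rw [sqi.inl_desc, ← hlL, Category.assoc, ← reassoc_of% hy, hm']
        · rw [sqi.inr_desc, reassoc_of% hlr, hm]
      rw [← this, reassoc_of% hs'']

/-! ### A representative set of presentable morphisms -/

/-- A `κ`-presentable morphism starting at a `κ`-filtered colimit is a pushout of a
`κ`-presentable morphism starting at some term of the diagram. -/
lemma presentableMorphisms.exists_isPushout_of_isColimit [IsCardinalLocallyPresentable C κ]
    {J : Type w} [SmallCategory J] [IsCardinalFiltered J κ] {F : J ⥤ C} {c : Cocone F}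
    (hc : IsColimit c) {Q' : C} {n' : c.pt ⟶ Q'} (hn' : presentableMorphisms C κ n') :
    ∃ (j : J) (Q : C) (n : F.obj j ⟶ Q) (q : Q ⟶ Q'), presentableMorphisms C κ n ∧
      IsPushout (c.ι.app j) n n' q := by
  obtain ⟨a, b, g, x, y, _, _, sq⟩ := hn'.exists_isPushout
  obtain ⟨j, x', hx'⟩ : ∃ (j : J) (x' : a ⟶ F.obj j), x' ≫ c.ι.app j = x :=
    IsCardinalPresentable.exists_hom_of_isColimit κ hc x
  have sq' := IsPushout.of_hasPushout x' g
  obtain ⟨i, hi⟩ : ∃ i : F.obj j ⟶ c.pt, i = c.ι.app j := ⟨_, rfl⟩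
  replace hx' : x' ≫ i = x := by rw [hi]; exact hx'
  obtain ⟨d, hd, hd'⟩ : ∃ d, pushout.inl x' g ≫ d = i ≫ n' ∧ pushout.inr x' g ≫ d = y :=
    ⟨_, pushout.inl_desc _ _ (by rw [reassoc_of% hx', sq.w]), pushout.inr_desc _ _ _⟩
  refine ⟨j, _, pushout.inl x' g, d, presentableMorphisms_of_isPushout sq'
    (presentableMorphisms_of_isCardinalPresentable g), ?_⟩
  have h : IsPushout i (pushout.inl x' g) n' d := by
    refine IsPushout.of_left ?_ hd.symm sq'
    rwa [hx', hd']
  rw [hi] at h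
  exact h

variable (C κ) in
/-- Up to pushouts, there is only a small set of `κ`-presentable morphisms. -/
lemma exists_small_family_isPushout [IsCardinalLocallyPresentable C κ] :
    ∃ (T : Type w) (a b : T → C) (g : ∀ t, a t ⟶ b t),
      ∀ ⦃A B : C⦄ (f : A ⟶ B), presentableMorphisms C κ f →
        ∃ (t : T) (x : a t ⟶ A) (y : b t ⟶ B), IsPushout x (g t) f y := by
  obtain ⟨S, _, -, hS'⟩ := ObjectProperty.EssentiallySmall.exists_small_le.{w}
    (isCardinalPresentable C κ)
  let e := equivShrink.{w} (Subtype S)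
  refine ⟨Σ (p : Shrink.{w} (Subtype S) × Shrink.{w} (Subtype S)),
    Shrink.{w} ((e.symm p.1).1 ⟶ (e.symm p.2).1), fun t => (e.symm t.1.1).1,
    fun t => (e.symm t.1.2).1, fun t => (equivShrink _).symm t.2,
    fun A B f hf => ?_⟩
  obtain ⟨a, b, g, x, y, ha, hb, sq⟩ := hf.exists_isPushout
  obtain ⟨a', ha', ⟨ea⟩⟩ := hS' a ha
  obtain ⟨b', hb', ⟨eb⟩⟩ := hS' b hb
  obtain ⟨a', rfl⟩ : ∃ i, (e.symm i).1 = a' := ⟨e ⟨a', ha'⟩, by simp⟩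
  obtain ⟨b', rfl⟩ : ∃ i, (e.symm i).1 = b' := ⟨e ⟨b', hb'⟩, by simp⟩
  refine ⟨⟨⟨a', b'⟩, equivShrink _ (ea.inv ≫ g ≫ eb.hom)⟩, ea.inv ≫ x, eb.inv ≫ y, ?_⟩
  refine IsPushout.of_iso sq ea (Iso.refl _) eb (Iso.refl _) (by simp) ?_ (by simp) (by simp)
  simp

/-! ### Injectivity and orthogonality classes of morphisms -/

section Orthogonality

variable (P : ObjectProperty C)

lemma injectiveMorphisms_of_isPushout {A B A' B' : C} {f : A ⟶ B} {g : A ⟶ A'} {f' : A' ⟶ B'}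
    {g' : B ⟶ B'} (sq : IsPushout g f f' g') (hf : injectiveMorphisms P f) :
    injectiveMorphisms P f' := by
  intro K hK u
  obtain ⟨t, ht⟩ := hf K hK (g ≫ u)
  exact ⟨sq.desc u t ht.symm, by simp⟩

variable {P} in
lemma orthogonalMorphisms_iff {A B : C} {f : A ⟶ B} :
    orthogonalMorphisms P f ↔ injectiveMorphisms P f ∧
      ∀ (K : C) (_ : P K) (u v : B ⟶ K), f ≫ u = f ≫ v → u = v := by
  refine ⟨fun h => ⟨fun K hK u => (h K hK u).exists, fun K hK u v huv =>
    (h K hK (f ≫ v)).unique huv rfl⟩, fun h K hK u => ?_⟩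
  obtain ⟨t, ht⟩ := h.1 K hK u
  exact ⟨t, ht, fun t' ht' => h.2 K hK _ _ (ht'.trans ht.symm)⟩

/-- If the pushout `f'` of `f` along `g` belongs to `P^▽` and so does `g`, then so does `f`. -/
lemma injectiveMorphisms_of_isPushout' {A B A' B' : C} {f : A ⟶ B} {g : A ⟶ A'} {f' : A' ⟶ B'}
    {g' : B ⟶ B'} (sq : IsPushout g f f' g') (hg : injectiveMorphisms P g)
    (hf' : injectiveMorphisms P f') : injectiveMorphisms P f := by
  intro K hK u
  obtain ⟨u', hu'⟩ := hg K hK u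
  obtain ⟨t, ht⟩ := hf' K hK u'
  exact ⟨g' ≫ t, by rw [← sq.w_assoc, ht, hu']⟩

lemma orthogonalMorphisms_of_isPushout' {A B A' B' : C} {f : A ⟶ B} {g : A ⟶ A'} {f' : A' ⟶ B'}
    {g' : B ⟶ B'} (sq : IsPushout g f f' g') (hg : orthogonalMorphisms P g)
    (hf' : orthogonalMorphisms P f') : orthogonalMorphisms P f := by
  rw [orthogonalMorphisms_iff] at hg hf' ⊢
  refine ⟨injectiveMorphisms_of_isPushout' P sq hg.1 hf'.1, fun K hK u v huv => ?_⟩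
  obtain ⟨u', hu'⟩ := hg.1 K hK (f ≫ u)
  have : sq.desc u' u hu' = sq.desc u' v (hu'.trans huv) := hf'.2 K hK _ _ (by simp)
  rw [← sq.inr_desc u' u hu', this, sq.inr_desc]

lemma orthogonalMorphisms_of_isPushout {A B A' B' : C} {f : A ⟶ B} {g : A ⟶ A'} {f' : A' ⟶ B'}
    {g' : B ⟶ B'} (sq : IsPushout g f f' g') (hf : orthogonalMorphisms P f) :
    orthogonalMorphisms P f' := by
  rw [orthogonalMorphisms_iff] at hf ⊢
  refine ⟨injectiveMorphisms_of_isPushout P sq hf.1, fun K hK u v huv => ?_⟩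
  refine sq.hom_ext huv (hf.2 K hK _ _ ?_)
  rw [← sq.w_assoc, ← sq.w_assoc, huv]

variable {P} in
lemma orthogonalMorphisms_comp {X Y Z : C} {f : X ⟶ Y} {g : Y ⟶ Z}
    (hf : orthogonalMorphisms P f) (hg : orthogonalMorphisms P g) :
    orthogonalMorphisms P (f ≫ g) := by
  intro K hK u
  obtain ⟨t, ht, ht'⟩ := hf K hK u
  obtain ⟨s, hs, hs'⟩ := hg K hK t
  exact ⟨s, by simp [hs, ht], fun s' h' => hs' _ (ht' _ (by simpa using h'))⟩

variable {P} in
lemma orthogonalMorphisms_of_precomp {X Y Z : C} {f : X ⟶ Y} {g : Y ⟶ Z}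
    (hf : orthogonalMorphisms P f) (hfg : orthogonalMorphisms P (f ≫ g)) :
    orthogonalMorphisms P g := by
  intro K hK u
  obtain ⟨s, hs, hs'⟩ := hfg K hK (f ≫ u)
  refine ⟨s, (hf K hK (f ≫ u)).unique (by simpa using hs) rfl, fun s' h' => hs' _ ?_⟩
  change (f ≫ g) ≫ s' = f ≫ u
  rw [Category.assoc, show g ≫ s' = u from h']

lemma orthogonalMorphisms_of_isColimit {A : C} {J : Type*} [Category J] {F : J ⥤ Under A}
    {c : Cocone F} (hc : IsColimit c) (hF : ∀ j, orthogonalMorphisms P (F.obj j).hom) :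
    orthogonalMorphisms P c.pt.hom := by
  intro K hK u
  choose t ht ht' using fun j => hF j K hK u
  let s : Cocone F := Cocone.mk (Under.mk u)
    { app j := Under.homMk (t j) (ht j)
      naturality i j a := by
        ext
        have h : (F.map a).right ≫ t j = t i := ht' i _ (by
          change (F.obj i).hom ≫ (F.map a).right ≫ t j = u
          rw [Under.w_assoc, ht])
        exact h.trans (Category.comp_id _).symm }
  refine ⟨(hc.desc s).right, Under.w (hc.desc s), fun m hm => ?_⟩
  have : (Under.homMk m hm : c.pt ⟶ Under.mk u) = hc.desc s := by
    refine hc.uniq s _ (fun j => ?_)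
    ext
    refine ht' j _ ?_
    change (F.obj j).hom ≫ (c.ι.app j).right ≫ m = u
    rw [Under.w_assoc]
    exact hm
  exact congr($(this).right)

end Orthogonality

/-! ### The orthogonal factorization -/

variable (κ) in
/-- The objects of `A ↓ C` given by the members of `κ-P^⊤` with domain `A`. -/
def presentableUnder (P : ObjectProperty C) (A : C) : ObjectProperty (Under A) :=
  fun X => presentableMembers (orthogonalMorphisms P) κ X.hom

lemma isClosedUnderColimitsOfShape_presentableUnder [LocallySmall.{w} C] (P : ObjectProperty C)
    (A : C) {J : Type*} [Category J] [HasLimitsOfShape Jᵒᵖ (Type w)]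
    (hJ : HasCardinalLT (Arrow J) κ) :
    (presentableUnder κ P A).IsClosedUnderColimitsOfShape J where
  colimitsOfShape_le := by
    rintro X ⟨hX⟩
    have := isClosedUnderColimitsOfShape_isCardinalPresentable (Under A) hJ
    exact ⟨orthogonalMorphisms_of_isColimit P hX.isColimit (fun j => (hX.prop_diag_obj j).1),
      (isCardinalPresentable (Under A) κ).prop_of_isColimit hX.isColimit
        (fun j => (hX.prop_diag_obj j).2)⟩

instance essentiallySmall_presentableUnder [IsCardinalLocallyPresentable C κ]
    (P : ObjectProperty C) (A : C) :
    ObjectProperty.EssentiallySmall.{w} (presentableUnder κ P A) where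
  exists_small_le' := by
    obtain ⟨T, a, b, g, hg⟩ := exists_small_family_isPushout C κ
    let X (i : Σ t, Shrink.{w} (a t ⟶ A)) : Under A :=
      Under.mk (pushout.inl ((equivShrink _).symm i.2) (g i.1))
    refine ⟨ObjectProperty.ofObj X, inferInstance, fun Y hY => ?_⟩
    obtain ⟨t, x, y, sq⟩ := hg Y.hom hY.2
    refine ⟨X ⟨t, equivShrink _ x⟩, ObjectProperty.ofObj_apply X _, ⟨?_⟩⟩
    have sq' : IsPushout x (g t) (pushout.inl ((equivShrink _).symm (equivShrink _ x)) (g t))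
        (pushout.inr ((equivShrink _).symm (equivShrink _ x)) (g t)) := by
      convert IsPushout.of_hasPushout ((equivShrink _).symm (equivShrink _ x)) (g t) using 1
      simp
    exact Under.isoMk (sq.isoIsPushout _ _ sq') (by
      change Y.hom ≫ _ = pushout.inl _ _
      simp)

/-- The canonical diagram of an object `X` with respect to an essentially small class of objects
closed under `κ`-small colimits: its terms are all the morphisms to `X` from objects of the class,
so that a factorization of a term through an object of the class is again a term. -/
lemma exists_filtered_canonical_diagram {D : Type*} [Category.{v} D] [LocallySmall.{w} D]
    [HasColimitsOfSize.{w, w} D] (P : ObjectProperty D) [ObjectProperty.EssentiallySmall.{w} P]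
    (hP : ∀ (J : Type w) [SmallCategory J], HasCardinalLT (Arrow J) κ →
      P.IsClosedUnderColimitsOfShape J) (X : D) :
    ∃ (J : Type w) (_ : SmallCategory J) (_ : IsCardinalFiltered J κ) (G : J ⥤ D)
      (_ : G.Faithful) (s : G ⟶ (Functor.const J).obj X), (∀ j, P (G.obj j)) ∧
      ∀ (j : J) (Z : D) (n : G.obj j ⟶ Z) (y : Z ⟶ X), P Z → n ≫ y = s.app j →
        ∃ (j' : J) (a : j ⟶ j') (t : Z ⟶ G.obj j'), n ≫ t = G.map a ∧
          (t ≫ s.app j' : Z ⟶ X) = y := by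
  have : IsCardinalFiltered (CostructuredArrow P.ι X) κ :=
    { nonempty_cocone {J} _ K hJ := ⟨by
        have := hP J hJ
        exact colimit.cocone K⟩ }
  let e := equivSmallModel.{w} (CostructuredArrow P.ι X)
  have : IsCardinalFiltered (SmallModel.{w} (CostructuredArrow P.ι X)) κ :=
    IsCardinalFiltered.of_equivalence κ e
  let V : CostructuredArrow P.ι X ⥤ D := CostructuredArrow.proj _ _ ⋙ P.ι
  refine ⟨SmallModel.{w} (CostructuredArrow P.ι X), inferInstance, inferInstance, e.inverse ⋙ V,
    inferInstance,
    { app j := (e.inverse.obj j).hom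
      naturality j j' a := by
        refine Eq.trans ?_ (Category.comp_id _).symm
        exact CostructuredArrow.w (e.inverse.map a) },
    fun j => (e.inverse.obj j).left.property, fun j Z n y hZ h => ?_⟩
  let W : CostructuredArrow P.ι X := CostructuredArrow.mk (S := P.ι) (Y := ⟨Z, hZ⟩)
    (show P.ι.obj ⟨Z, hZ⟩ ⟶ X from y)
  let φ : e.inverse.obj j ⟶ W := CostructuredArrow.homMk ⟨n⟩ (by exact h)
  obtain ⟨a, ha⟩ := e.inverse.map_surjective (φ ≫ e.unitIso.hom.app W)
  refine ⟨e.functor.obj W, a, V.map (e.unitIso.hom.app W), ?_, ?_⟩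
  · change V.map φ ≫ V.map (e.unitIso.hom.app W) = V.map (e.inverse.map a)
    rw [ha, V.map_comp]
  · exact CostructuredArrow.w (e.unitIso.hom.app W)

/-- The factorization of `f : A ⟶ B` through the colimit `X` of all the factorizations
`A ⟶ Y ⟶ B` of `f` with `A ⟶ Y` in `κ-P^⊤`: morphisms in `A ↓ C` from a term of this diagram to a
further factorization lift to `X`, and they do so uniquely. -/
lemma exists_filtered_factorization [IsCardinalLocallyPresentable C κ] (P : ObjectProperty C)
    {A B : C} (f : A ⟶ B) :
    ∃ (D : Type w) (_ : SmallCategory D) (_ : IsCardinalFiltered D κ) (G : D ⥤ Under A)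
      (_ : G.Faithful) (c : Cocone G) (m : c.pt ⟶ Under.mk f),
      (∀ d, presentableUnder κ P A (G.obj d)) ∧ Nonempty (IsColimit c) ∧
      (∀ (d : D) (Z : Under A) (n : G.obj d ⟶ Z) (y : Z ⟶ Under.mk f),
        presentableUnder κ P A Z → n ≫ y = c.ι.app d ≫ m →
        ∃ l : Z ⟶ c.pt, n ≫ l = c.ι.app d ∧ l ≫ m = y) ∧
      (∀ (d : D) (Z : Under A) (t₁ t₂ : Z ⟶ G.obj d), presentableUnder κ P A Z →
        t₁ ≫ c.ι.app d ≫ m = t₂ ≫ c.ι.app d ≫ m →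
        (t₁ ≫ c.ι.app d : Z ⟶ c.pt) = t₂ ≫ c.ι.app d) := by
  obtain ⟨D, _, _, G, hG, s, hG', key⟩ := exists_filtered_canonical_diagram (κ := κ)
    (presentableUnder κ P A) (fun J _ hJ => isClosedUnderColimitsOfShape_presentableUnder P A hJ)
    (Under.mk f)
  obtain ⟨m, hm⟩ : ∃ m : colimit G ⟶ Under.mk f, ∀ d, colimit.ι G d ≫ m = s.app d :=
    ⟨colimit.desc G (Cocone.mk _ s), fun d => colimit.ι_desc _ _⟩
  have key' (d) (Z : Under A) (n : G.obj d ⟶ Z) (y : Z ⟶ Under.mk f)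
      (hZ : presentableUnder κ P A Z) (h : n ≫ y = colimit.ι G d ≫ m) :
      ∃ l : Z ⟶ colimit G, n ≫ l = colimit.ι G d ∧ l ≫ m = y := by
    obtain ⟨j', a, t, ht, ht'⟩ := key d Z n y hZ (h.trans (hm d))
    refine ⟨t ≫ colimit.ι G j', ?_, ?_⟩
    · rw [← Category.assoc, ht, colimit.w]
    · rw [Category.assoc, hm, ht']
  refine ⟨D, inferInstance, inferInstance, G, hG, colimit.cocone G, m, hG',
    ⟨colimit.isColimit G⟩, key', fun d Z t₁ t₂ hZ h => ?_⟩
  -- the coequalizer of the two morphisms is again a factorization of `f`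
  have := isClosedUnderColimitsOfShape_presentableUnder P A
    (hasCardinalLT_arrow_of_finCategory κ WalkingParallelPair)
  have hQ : presentableUnder κ P A (coequalizer t₁ t₂) := by
    apply (presentableUnder κ P A).prop_colimit
    rintro (_ | _)
    exacts [hZ, hG' d]
  obtain ⟨l, hl, -⟩ := key' d _ (coequalizer.π t₁ t₂) (coequalizer.desc (colimit.ι G d ≫ m) h) hQ
    (coequalizer.π_desc _ _)
  change t₁ ≫ colimit.ι G d = t₂ ≫ colimit.ι G d
  rw [← hl, coequalizer.condition_assoc]

/-- A terminal category is `κ`-filtered, so that `Fc_κ(N)` contains `N`. -/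
lemma le_filteredColimits (N : MorphismProperty C) : N ≤ filteredColimits N κ := by
  intro A B f hf
  refine ⟨Discrete PUnit.{w + 1}, inferInstance, ?_, Functor.fromPUnit (Under.mk f), ?_,
    fun _ => hf, { app _ := 𝟙 B }, ⟨?_⟩, fun _ => Category.comp_id f⟩
  · exact IsTerminal.isCardinalFiltered (X := (⟨⟨⟩⟩ : Discrete PUnit.{w + 1}))
      (IsTerminal.ofUniqueHom (fun _ => 𝟙 _) (fun _ _ => Subsingleton.elim _ _)) κ
  · exact ⟨fun _ => Subsingleton.elim _ _⟩
  · exact IsColimit.ofExistsUnique (fun s => ⟨s.ι.app ⟨⟨⟩⟩, fun ⟨⟨⟩⟩ => Category.id_comp _,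
      fun m hm => (Category.id_comp m).symm.trans (hm ⟨⟨⟩⟩)⟩)

lemma filteredColimits_comp_iso {N : MorphismProperty C} {A B B' : C} {f : A ⟶ B} (i : B ≅ B')
    (hf : filteredColimits N κ f) : filteredColimits N κ (f ≫ i.hom) := by
  obtain ⟨D, _, _, F, _, hF, ι, ⟨hι⟩, h⟩ := hf
  refine ⟨D, inferInstance, inferInstance, F, inferInstance, hF,
    ι ≫ (Functor.const D).map i.hom, ⟨IsColimit.ofIsoColimit hι (Cocone.ext i)⟩, fun d => ?_⟩
  change _ ≫ ι.app d ≫ i.hom = _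
  rw [← h d]
  exact (Category.assoc _ _ _).symm

lemma filteredColimits_le_orthogonalLeft (N : MorphismProperty C) :
    filteredColimits N κ ≤ orthogonalLeft (orthogonalRight N) := by
  rintro A B f ⟨D, _, _, F, _, hF, ι, ⟨hι⟩, h⟩ X Y i hi s t hst
  have := isFiltered_of_isCardinalFiltered D κ
  obtain ⟨d₀⟩ := IsFiltered.nonempty (C := D)
  have h' (d) : s ≫ i = (F.obj d).hom ≫ ι.app d ≫ t := by
    rw [hst, ← h d]
    exact Category.assoc _ _ _
  choose l hl hl' using fun d => hi _ (hF d) s (ι.app d ≫ t) (h' d)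
  have hnat (d d' : D) (a : d ⟶ d') : (F.map a).right ≫ l d' = l d := by
    have h₁ : (F.map a).right ≫ ι.app d' = ι.app d :=
      (ι.naturality a).trans (Category.comp_id _)
    refine hl' d _ ⟨?_, ?_⟩
    · rw [Under.w_assoc, (hl d').1]
    · rw [Category.assoc, (hl d').2]
      exact (Category.assoc _ _ _).symm.trans congr($h₁ ≫ t)
  let c : Cocone (F ⋙ Under.forget A) := Cocone.mk X
    { app := l, naturality d d' a := (hnat d d' a).trans (Category.comp_id _).symm }
  have hc (d) : ι.app d ≫ hι.desc c = l d := hι.fac c d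
  refine ⟨hι.desc c, ⟨?_, ?_⟩, fun m hm => hι.uniq c m (fun d => hl' d _ ⟨?_, ?_⟩)⟩
  · rw [← h d₀]
    exact (Category.assoc _ _ _).trans (congr((F.obj d₀).hom ≫ $(hc d₀)).trans (hl d₀).1)
  · refine hι.hom_ext (fun d => ?_)
    refine (Category.assoc _ _ _).symm.trans (congr($(hc d) ≫ i).trans (hl d).2)
  · refine Eq.trans (Category.assoc _ _ _).symm ?_
    exact congr($(h d) ≫ m).trans hm.1
  · refine (Category.assoc _ _ _).trans ?_
    exact congr(ι.app d ≫ $(hm.2))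

/-- If every morphism factors as a member of `Fc_κ(N)` followed by a morphism orthogonal to `N`,
then this is a factorization system. -/
lemma isFactorizationSystem_of_exists_factorization (N : MorphismProperty C)
    (h : ∀ ⦃A B : C⦄ (f : A ⟶ B), ∃ (X : C) (e : A ⟶ X) (m : X ⟶ B),
      filteredColimits N κ e ∧ orthogonalRight N m ∧ e ≫ m = f) :
    IsFactorizationSystem (filteredColimits N κ) (orthogonalRight N) where
  orthogonalLeft_eq := by
    refine le_antisymm (fun A B p hp => ?_) (filteredColimits_le_orthogonalLeft N)
    obtain ⟨X, e, m, he, hm, rfl⟩ := h p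
    obtain ⟨d, ⟨hd, hd'⟩, -⟩ := hp m hm e (𝟙 B) (by simp)
    obtain ⟨x, -, hx⟩ := filteredColimits_le_orthogonalLeft N e he m hm e m rfl
    have hmd : m ≫ d = 𝟙 X :=
      (hx (m ≫ d) ⟨by simpa using hd, by simp [hd']⟩).trans (hx (𝟙 X) (by simp)).symm
    exact filteredColimits_comp_iso ⟨m, d, hmd, hd'⟩ he
  orthogonalRight_eq := le_antisymm (fun X Y i hi A B p hp => hi p (le_filteredColimits N p hp))
    (fun X Y i hi A B p hp => filteredColimits_le_orthogonalLeft N p hp i hi)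
  exists_factorization := h

/-- The colimit of the factorizations of `f` through members of `κ-P^⊤` yields a factorization whose
second part is orthogonal to all members of `κ-P^⊤`. -/
lemma exists_factorization_filteredColimits [IsCardinalLocallyPresentable C κ]
    (P : ObjectProperty C) {A B : C} (f : A ⟶ B) :
    ∃ (X : C) (e : A ⟶ X) (m : X ⟶ B),
      filteredColimits (presentableMembers (orthogonalMorphisms P) κ) κ e ∧
      orthogonalRight (presentableMembers (orthogonalMorphisms P) κ) m ∧ e ≫ m = f := by
  obtain ⟨D, _, _, G, _, c, m, hG, ⟨hc⟩, hex, huniq⟩ :=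
    exists_filtered_factorization (κ := κ) P f
  have := isFiltered_of_isCardinalFiltered D κ
  have := IsFiltered.isConnected D
  obtain ⟨ι, hι, hcX, hw⟩ : ∃ (ι : ∀ d, (G.obj d).right ⟶ c.pt.right)
      (hι : ∀ d, ι d = (c.ι.app d).right)
      (h : IsColimit ((Under.forget A).mapCocone c)), ∀ d, (G.obj d).hom ≫ ι d = c.pt.hom :=
    ⟨_, fun d => rfl, isColimitOfPreserves (Under.forget A) hc, fun d => Under.w (c.ι.app d)⟩
  have hιT (d) : orthogonalMorphisms P (ι d) := by
    refine orthogonalMorphisms_of_precomp (hG d).1 ?_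
    rw [hw]
    exact orthogonalMorphisms_of_isColimit P hc (fun d => (hG d).1)
  refine ⟨c.pt.right, c.pt.hom, m.right,
    ⟨D, inferInstance, inferInstance, G, inferInstance, hG,
      Functor.whiskerRight c.ι (Under.forget A), ⟨hcX⟩, fun d => Under.w (c.ι.app d)⟩,
    fun A' Q n hn s t hst => ?_, Under.w m⟩
  have sq := IsPushout.of_hasPushout s n
  obtain ⟨y', hy'⟩ : ∃ y', y' = sq.desc m.right t hst := ⟨_, rfl⟩
  -- The lifts are the retractions over `B` of the pushout of `n`, which is in turn a pushout of
  -- some `n''` starting at a term of the diagram.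
  obtain ⟨d, Q'', n'', q, hn'', sq''⟩ : ∃ (d : D) (Q'' : C) (n'' : (G.obj d).right ⟶ Q'')
      (q : Q'' ⟶ pushout s n),
      presentableMorphisms C κ n'' ∧ IsPushout (ι d) n'' (pushout.inl s n) q := by
    obtain ⟨d, Q'', n'', q, hn'', sq''⟩ :=
      (presentableMorphisms_of_isPushout sq hn.2).exists_isPushout_of_isColimit hcX
    refine ⟨d, Q'', n'', q, hn'', ?_⟩
    rw [hι]
    exact sq''
  have hn''T : orthogonalMorphisms P n'' := orthogonalMorphisms_of_isPushout' P sq'' (hιT d)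
    (orthogonalMorphisms_of_isPushout P sq hn.1)
  let Z : Under A := Under.mk ((G.obj d).hom ≫ n'')
  have hZ : presentableUnder κ P A Z :=
    ⟨orthogonalMorphisms_comp (hG d).1 hn''T, presentableMorphisms_comp (hG d).2 hn''⟩
  have hιm : n'' ≫ q ≫ y' = ι d ≫ m.right := by
    rw [← sq''.w_assoc, hy', sq.inl_desc]
  have hfm : (G.obj d).hom ≫ ι d ≫ m.right = f := by
    rw [← Category.assoc, hw]
    exact Under.w m
  obtain ⟨l, hl, hl'⟩ := hex d Z (Under.homMk n'' rfl) (Under.homMk (q ≫ y') (by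
    change ((G.obj d).hom ≫ n'') ≫ q ≫ y' = f
    rw [Category.assoc, hιm, hfm])) hZ (by
      ext
      change n'' ≫ q ≫ y' = (c.ι.app d).right ≫ m.right
      rw [hιm, hι])
  obtain ⟨l', hl₁, hl₂⟩ : ∃ l' : Q'' ⟶ c.pt.right, n'' ≫ l' = ι d ∧ l' ≫ m.right = q ≫ y' :=
    ⟨l.right, (congr($(hl).right)).trans (hι d).symm, congr($(hl').right)⟩
  have hρ : ι d ≫ 𝟙 _ = n'' ≫ l' := by rw [hl₁, Category.comp_id]
  have hρm : sq''.desc (𝟙 _) l' hρ ≫ m.right = y' := by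
    apply sq''.hom_ext
    · rw [sq''.inl_desc_assoc, Category.id_comp, hy', sq.inl_desc]
    · rw [sq''.inr_desc_assoc, hl₂]
  refine existsUnique_of_exists_of_unique ⟨pushout.inr s n ≫ sq''.desc (𝟙 _) l' hρ, ?_, ?_⟩ ?_
  · rw [← sq.w_assoc, sq''.inl_desc, Category.comp_id]
  · rw [Category.assoc, hρm, hy', sq.inr_desc]
  · rintro d₁ d₂ ⟨h₁, h₁'⟩ ⟨h₂, h₂'⟩
    have aux (x : Q ⟶ c.pt.right) (hx : n ≫ x = s) (hx' : x ≫ m.right = t) :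
        ∃ r : pushout s n ⟶ c.pt.right, pushout.inr s n ≫ r = x ∧ n'' ≫ q ≫ r = ι d ∧
          r ≫ m.right = y' ∧ pushout.inl s n ≫ r = 𝟙 _ := by
      have h : s ≫ 𝟙 _ = n ≫ x := by rw [hx, Category.comp_id]
      refine ⟨sq.desc (𝟙 _) x h, sq.inr_desc _ _ _, ?_, ?_, sq.inl_desc _ _ _⟩
      · rw [← sq''.w_assoc, sq.inl_desc, Category.comp_id]
      · rw [hy']
        apply sq.hom_ext
        · rw [sq.inl_desc_assoc, Category.id_comp, sq.inl_desc]
        · rw [sq.inr_desc_assoc, hx', sq.inr_desc]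
    obtain ⟨r₁, hr₁, hr₁', hr₁'', hi₁⟩ := aux d₁ h₁ h₁'
    obtain ⟨r₂, hr₂, hr₂', hr₂'', hi₂⟩ := aux d₂ h₂ h₂'
    have fac (x : Q'' ⟶ c.pt.right) (hx : n'' ≫ x = ι d) : ∃ (k : D) (a : d ⟶ k)
        (t : Q'' ⟶ (G.obj k).right), n'' ≫ t = (G.map a).right ∧ t ≫ ι k = x := by
      obtain ⟨k, a, t, ht, ht'⟩ := hn''.exists_factorization hcX (j := d)
        (𝟙 _) x ((hx.trans (hι d)).trans (Category.id_comp _).symm)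
      exact ⟨k, a, t, ht.trans (Category.id_comp _), by rw [hι]; exact ht'⟩
    obtain ⟨k₁, a₁, t₁, ht₁, ht₁'⟩ := fac _ hr₁'
    obtain ⟨k₂, a₂, t₂, ht₂, ht₂'⟩ := fac _ hr₂'
    obtain ⟨k, b₁, b₂, hb⟩ := IsFiltered.span a₁ a₂
    have hw' (k' : D) (b : k' ⟶ k) : (G.map b).right ≫ ι k = ι k' := by
      rw [hι, hι, ← c.w b]
      rfl
    have hZt (k' : D) (a : d ⟶ k') (t : Q'' ⟶ (G.obj k').right) (ht : n'' ≫ t = (G.map a).right)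
        (b : k' ⟶ k) : Z.hom ≫ t ≫ (G.map b).right = (G.obj k).hom := by
      change ((G.obj d).hom ≫ n'') ≫ t ≫ (G.map b).right = (G.obj k).hom
      rw [Category.assoc, reassoc_of% ht, Under.w_assoc, Under.w]
    have := huniq k Z (Under.homMk (t₁ ≫ (G.map b₁).right) (hZt _ _ _ ht₁ _))
      (Under.homMk (t₂ ≫ (G.map b₂).right) (hZt _ _ _ ht₂ _)) hZ (by
        ext
        change (t₁ ≫ (G.map b₁).right) ≫ (c.ι.app k).right ≫ m.right =
          (t₂ ≫ (G.map b₂).right) ≫ (c.ι.app k).right ≫ m.right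
        have e₁ := hw' _ b₁
        have e₂ := hw' _ b₂
        rw [← hι, Category.assoc, Category.assoc, reassoc_of% e₁, reassoc_of% e₂,
          reassoc_of% ht₁', reassoc_of% ht₂', hr₁'', hr₂''])
    have h : q ≫ r₁ = q ≫ r₂ := by
      rw [← ht₁', ← ht₂', ← hw' _ b₁, ← hw' _ b₂, hι, ← Category.assoc, ← Category.assoc]
      exact congr($(this).right)
    rw [← hr₁, ← hr₂, sq''.hom_ext (hi₁.trans hi₂.symm) h]

/-! ### Concatenation of transfinite compositions -/

section LexSum

variable {J : Type w} [LinearOrder J] {K : J → Type w} [∀ j, LinearOrder (K j)]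

/-- The element `a` of the summand with index `i` of a lexicographic sum. -/
abbrev lexMk (i : J) (a : K i) : Σₗ j, K j := toLex ⟨i, a⟩

lemma lexMk_le_iff {i j : J} {a : K i} {b : K j} :
    lexMk i a ≤ lexMk j b ↔ i < j ∨ ∃ h : i = j, h ▸ a ≤ b :=
  Sigma.Lex.le_def

lemma lexMk_lt_iff {i j : J} {a : K i} {b : K j} :
    lexMk i a < lexMk j b ↔ i < j ∨ ∃ h : i = j, h ▸ a < b :=
  Sigma.Lex.lt_def

lemma wellFoundedLT_sigmaLex [WellFoundedLT J] [∀ j, WellFoundedLT (K j)] :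
    WellFoundedLT (Σₗ j, K j) where
  wf := by
    refine ⟨fun ⟨j, k⟩ => ?_⟩
    induction j using WellFoundedLT.induction with | _ j hj => ?_
    induction k using WellFoundedLT.induction with | _ k hk => ?_
    refine ⟨_, ?_⟩
    rintro ⟨j', k'⟩ (⟨_, _, h⟩ | ⟨_, _, h⟩)
    · exact hj _ h _
    · exact hk _ h

variable [SuccOrder J] (F : J ⥤ C) (G : ∀ j, K j ⥤ C)
  (inn : ∀ j k, F.obj j ⟶ (G j).obj k) (out : ∀ j k, (G j).obj k ⟶ F.obj (Order.succ j))

/-- The compatibilities satisfied by chains `G j` leading from `F.obj j` to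
`F.obj (Order.succ j)`. -/
structure LexCompat : Prop where
  inn_map (j : J) {k k' : K j} (h : k ≤ k') : inn j k ≫ (G j).map (homOfLE h) = inn j k'
  map_out (j : J) {k k' : K j} (h : k ≤ k') : (G j).map (homOfLE h) ≫ out j k' = out j k
  inn_out (j : J) (k : K j) : inn j k ≫ out j k = F.map (homOfLE (Order.le_succ j))

/-- The transition morphisms of the concatenation of a family of chains. -/
noncomputable def lexMap {i j : J} (a : K i) (b : K j) (h : lexMk i a ≤ lexMk j b) :
    (G i).obj a ⟶ (G j).obj b := by
  by_cases hlt : i < j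
  · exact out i a ≫ F.map (homOfLE (Order.succ_le_of_lt hlt)) ≫ inn j b
  · have e : i = j := by
      rcases lexMk_le_iff.1 h with h | ⟨h, -⟩
      exacts [(hlt h).elim, h]
    subst e
    exact (G i).map (homOfLE (by
      rcases lexMk_le_iff.1 h with h' | ⟨_, h'⟩
      exacts [(hlt h').elim, h']))

lemma lexMap_of_lt {i j : J} (a : K i) (b : K j) (h : lexMk i a ≤ lexMk j b)
    (hlt : i < j) : lexMap F G inn out a b h =
      out i a ≫ F.map (homOfLE (Order.succ_le_of_lt hlt)) ≫ inn j b :=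
  dif_pos hlt

lemma lexMap_self {i : J} (a b : K i) (h : lexMk i a ≤ lexMk i b) (hab : a ≤ b) :
    lexMap F G inn out a b h = (G i).map (homOfLE hab) :=
  dif_neg (lt_irrefl i)

variable {F G inn out} in
lemma lexMap_comp (h : LexCompat F G inn out) {i j k : J} (a : K i) (b : K j) (c : K k)
    (hf : lexMk i a ≤ lexMk j b) (hg : lexMk j b ≤ lexMk k c) :
    lexMap F G inn out a b hf ≫ lexMap F G inn out b c hg =
      lexMap F G inn out a c (hf.trans hg) := by
  obtain hij | ⟨rfl, hab⟩ := lexMk_le_iff.1 hf <;> obtain hjk | ⟨rfl, hbc⟩ := lexMk_le_iff.1 hg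
  · rw [lexMap_of_lt _ _ _ _ _ _ _ (hij.trans hjk), lexMap_of_lt _ _ _ _ _ _ _ hij,
      lexMap_of_lt _ _ _ _ _ _ _ hjk]
    simp only [Category.assoc]
    rw [← Category.assoc (inn j b), h.inn_out, ← F.map_comp_assoc, ← F.map_comp_assoc]
    rfl
  · rw [lexMap_of_lt _ _ _ _ _ _ _ hij, lexMap_of_lt _ _ _ _ _ _ _ hij,
      lexMap_self _ _ _ _ _ _ _ hbc]
    simp only [Category.assoc, h.inn_map]
  · rw [lexMap_of_lt _ _ _ _ _ _ _ hjk, lexMap_of_lt _ _ _ _ _ _ _ hjk,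
      lexMap_self _ _ _ _ _ _ _ hab, ← Category.assoc, h.map_out]
  · rw [lexMap_self _ _ _ _ _ _ _ hab, lexMap_self _ _ _ _ _ _ _ hbc,
      lexMap_self _ _ _ _ _ _ _ (le_trans hab hbc), ← Functor.map_comp]
    rfl

variable {F G inn out}

/-- The concatenation of the chains `G j`, each of which leads from `F.obj j` to
`F.obj (Order.succ j)`. -/
noncomputable def lexFunctor (h : LexCompat F G inn out) : (Σₗ j, K j) ⥤ C where
  obj p := (G (ofLex p).1).obj (ofLex p).2
  map {p q} f := lexMap F G inn out (ofLex p).2 (ofLex q).2 (leOfHom f)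
  map_id p := (lexMap_self _ _ _ _ _ _ _ le_rfl).trans ((G (ofLex p).1).map_id _)
  map_comp f g := (lexMap_comp h _ _ _ (leOfHom f) (leOfHom g)).symm

section WellOrderContinuous

variable {J : Type*} [LinearOrder J] {F : J ⥤ C}

lemma existsUnique_desc_of_isSuccLimit [F.IsWellOrderContinuous] {m : J} (hm : Order.IsSuccLimit m)
    {T : C} (s : ∀ i, i < m → (F.obj i ⟶ T))
    (hs : ∀ i i' (h : i ≤ i') (h' : i' < m), F.map (homOfLE h) ≫ s i' h' = s i (h.trans_lt h')) :
    ∃! d : F.obj m ⟶ T, ∀ i (h : i < m), F.map (homOfLE h.le) ≫ d = s i h := by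
  have hc := F.isColimitOfIsWellOrderContinuous m hm
  let c : Cocone ((Set.principalSegIio m).monotone.functor ⋙ F) := Cocone.mk T
    { app i := s i.1 i.2
      naturality i i' f := (hs i.1 i'.1 (leOfHom f) i'.2).trans (Category.comp_id _).symm }
  exact ⟨hc.desc c, fun i h => hc.fac c ⟨i, h⟩, fun d hd => hc.uniq c d (fun i => hd i.1 i.2)⟩

lemma isWellOrderContinuous_of_existsUnique_desc
    (h : ∀ (m : J), Order.IsSuccLimit m → ∀ {T : C} (s : ∀ i, i < m → (F.obj i ⟶ T)),
      (∀ i i' (h : i ≤ i') (h' : i' < m), F.map (homOfLE h) ≫ s i' h' = s i (h.trans_lt h')) →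
      ∃! d : F.obj m ⟶ T, ∀ i (h : i < m), F.map (homOfLE h.le) ≫ d = s i h) :
    F.IsWellOrderContinuous where
  nonempty_isColimit m hm := ⟨IsColimit.ofExistsUnique (fun c => by
    obtain ⟨d, hd, hd'⟩ := h m hm (fun i hi => c.ι.app ⟨i, hi⟩)
      (fun i i' h h' => c.w (homOfLE h : (⟨i, h.trans_lt h'⟩ : Set.Iio m) ⟶ ⟨i', h'⟩))
    exact ⟨d, fun i => hd i.1 i.2, fun d' h' => hd' d' (fun i hi => h' ⟨i, hi⟩)⟩)⟩

end WellOrderContinuous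

variable [∀ j, OrderBot (K j)]

/-- A colimit of the part of `F` given by a class `Q` of indices closed under successors is a
colimit of the corresponding part of the concatenation. -/
lemma existsUnique_desc_lex (h : LexCompat F G inn out) (Q : J → Prop)
    (hQ' : ∀ i, Q i → Q (Order.succ i)) {X T : C}
    (τ : ∀ i, Q i → (F.obj i ⟶ X))
    (hX : ∀ (s : ∀ i, Q i → (F.obj i ⟶ T)),
      (∀ i i' (h : i ≤ i') (hi : Q i) (hi' : Q i'), F.map (homOfLE h) ≫ s i' hi' = s i hi) →
      ∃! d : X ⟶ T, ∀ i (h : Q i), τ i h ≫ d = s i h)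
    (hτ : ∀ i i' (h : i ≤ i') (hi : Q i) (hi' : Q i'), F.map (homOfLE h) ≫ τ i' hi' = τ i hi)
    (hlt : ∀ i, Q i → i < Order.succ i)
    (s : ∀ i (a : K i), Q i → ((G i).obj a ⟶ T))
    (hs : ∀ i i' a a' (hle : lexMk i a ≤ lexMk i' a') (hi : Q i) (hi' : Q i'),
      lexMap F G inn out a a' hle ≫ s i' a' hi' = s i a hi) :
    ∃! d : X ⟶ T, ∀ i a (hi : Q i), out i a ≫ τ (Order.succ i) (hQ' i hi) ≫ d = s i a hi := by
  obtain ⟨d, hd, hd'⟩ := hX (fun i hi => inn i ⊥ ≫ s i ⊥ hi) (fun i i' hii' hi hi' => by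
    obtain rfl | hlt := hii'.eq_or_lt
    · simp
    · have := hs i i' ⊥ ⊥ (lexMk_le_iff.2 (Or.inl hlt)) hi hi'
      rw [lexMap_of_lt _ _ _ _ _ _ _ hlt, Category.assoc, Category.assoc] at this
      rw [← this, ← Category.assoc (inn i ⊥), h.inn_out, ← F.map_comp_assoc]
      rfl)
  refine ⟨d, fun i a hi => ?_, fun d' hd'' => hd' _ (fun i hi => ?_)⟩
  · have := hs i (Order.succ i) a ⊥ (lexMk_le_iff.2 (Or.inl (hlt i hi))) hi (hQ' i hi)
    rw [lexMap_of_lt _ _ _ _ _ _ _ (hlt i hi), Category.assoc, Category.assoc] at this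
    rw [hd, ← this]
    have h' : F.map (homOfLE (Order.succ_le_of_lt (hlt i hi))) = 𝟙 _ := F.map_id _
    rw [h', Category.id_comp]
  · rw [← hd'' i ⊥ hi, ← Category.assoc, h.inn_out, ← Category.assoc, hτ _ _ _ hi]

lemma existsUnique_desc_lex_of_isColimit [NoMaxOrder J] (h : LexCompat F G inn out)
    {c : Cocone F} (hc : IsColimit c) {T : C} (s : ∀ i (a : K i), (G i).obj a ⟶ T)
    (hs : ∀ i i' a a' (hle : lexMk i a ≤ lexMk i' a'),
      lexMap F G inn out a a' hle ≫ s i' a' = s i a) :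
    ∃! d : c.pt ⟶ T, ∀ i a, out i a ≫ c.ι.app (Order.succ i) ≫ d = s i a := by
  have := existsUnique_desc_lex h (fun _ => True) (fun _ _ => trivial) (X := c.pt) (T := T)
    (fun i _ => c.ι.app i) (fun s hs => ?_) (fun i i' hle _ _ => c.w _)
    (fun i _ => Order.lt_succ i) (fun i a _ => s i a) (fun i i' a a' hle _ _ => hs i i' a a' hle)
  · simpa using this
  · let c' : Cocone F := Cocone.mk T
      { app i := s i trivial
        naturality i i' f := (hs i i' (leOfHom f) trivial trivial).trans
          (Category.comp_id _).symm }
    exact ⟨hc.desc c', fun i _ => hc.fac c' i, fun d hd => hc.uniq c' d (fun i => hd i trivial)⟩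

/-- `F.obj j` is the colimit of the part of the concatenation formed by the summands before `j`. -/
lemma existsUnique_desc_lex_Iio [NoMaxOrder J] [F.IsWellOrderContinuous]
    (h : LexCompat F G inn out)
    (hG : ∀ j, IsColimit (Cocone.mk (F.obj (Order.succ j))
      { app := out j, naturality := fun _ _ f => (h.map_out j (leOfHom f)).trans
          (Category.comp_id _).symm } : Cocone (G j)))
    {j : J} (hj : ¬ IsMin j) {T : C} (s : ∀ i (a : K i), i < j → ((G i).obj a ⟶ T))
    (hs : ∀ i i' a a' (hle : lexMk i a ≤ lexMk i' a') (hi : i < j) (hi' : i' < j),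
      lexMap F G inn out a a' hle ≫ s i' a' hi' = s i a hi) :
    ∃! d : F.obj j ⟶ T, ∀ i a (hi : i < j),
      out i a ≫ F.map (homOfLE (Order.succ_le_of_lt hi)) ≫ d = s i a hi := by
  by_cases hl : Order.IsSuccLimit j
  · exact existsUnique_desc_lex h (fun i => i < j) (fun i hi => hl.succ_lt hi)
      (fun i hi => F.map (homOfLE hi.le))
      (fun s hs => existsUnique_desc_of_isSuccLimit hl s
        (fun i i' hle hi' => hs i i' hle (hle.trans_lt hi') hi'))
      (fun i i' hle hi hi' => by rw [← F.map_comp]; rfl) (fun i _ => Order.lt_succ i) s hs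
  · obtain ⟨i, rfl⟩ : ∃ i, Order.succ i = j := by
      have : ¬ Order.IsSuccPrelimit j := fun h' => hl ⟨hj, h'⟩
      exact Order.not_isSuccPrelimit_iff_mem_range_succ.1 this
    have hi := Order.lt_succ i
    have hid : F.map (homOfLE (Order.succ_le_of_lt hi)) = 𝟙 _ := F.map_id _
    let c : Cocone (G i) := Cocone.mk T
      { app a := s i a hi
        naturality a a' f := by
          have := hs i i a a' (lexMk_le_iff.2 (Or.inr ⟨rfl, leOfHom f⟩)) hi hi
          rw [lexMap_self _ _ _ _ _ _ _ (leOfHom f)] at this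
          exact this.trans (Category.comp_id _).symm }
    have hfac (a : K i) : out i a ≫ (hG i).desc c = s i a hi := (hG i).fac c a
    refine ⟨(hG i).desc c, fun i' a hi' => ?_, fun d hd => (hG i).uniq c d (fun a => ?_)⟩
    · obtain rfl | hlt := (Order.le_of_lt_succ hi').eq_or_lt
      · rw [hid, Category.id_comp, hfac]
      · have := hs i' i a ⊥ (lexMk_le_iff.2 (Or.inl hlt)) hi' hi
        rw [lexMap_of_lt _ _ _ _ _ _ _ hlt, Category.assoc, Category.assoc, ← hfac,
          ← Category.assoc (inn i ⊥), h.inn_out, ← F.map_comp_assoc] at this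
        exact this
    · have := hd i a hi
      rwa [hid, Category.id_comp] at this

/-- The concatenation is continuous: its limit elements are the limit elements of the summands and
the least elements of those summands which are preceded by summands without a greatest element. -/
lemma isWellOrderContinuous_lexFunctor [NoMaxOrder J] [∀ j, SuccOrder (K j)]
    [F.IsWellOrderContinuous]
    [∀ j, (G j).IsWellOrderContinuous] (h : LexCompat F G inn out) (hbot : ∀ j, IsIso (inn j ⊥))
    (hG : ∀ j, IsColimit (Cocone.mk (F.obj (Order.succ j))
      { app := out j, naturality := fun _ _ f => (h.map_out j (leOfHom f)).trans
          (Category.comp_id _).symm } : Cocone (G j))) :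
    (lexFunctor h).IsWellOrderContinuous := by
  refine isWellOrderContinuous_of_existsUnique_desc ?_
  rintro ⟨j, b⟩ hm T s' hs'
  change Order.IsSuccLimit (lexMk j b) at hm
  obtain ⟨s, hs⟩ : ∃ (s : ∀ i (a : K i), lexMk i a < lexMk j b → ((G i).obj a ⟶ T)),
      ∀ i i' a a' (hle : lexMk i a ≤ lexMk i' a') (h' : lexMk i' a' < lexMk j b),
        lexMap F G inn out a a' hle ≫ s i' a' h' = s i a (hle.trans_lt h') ∧
        s i a (hle.trans_lt h') = s' _ (hle.trans_lt h') :=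
    ⟨fun i a h => s' _ h, fun i i' a a' hle h' => ⟨hs' _ _ hle h', rfl⟩⟩
  suffices ∃! d : (G j).obj b ⟶ T, ∀ i (a : K i) (h : lexMk i a < lexMk j b),
      lexMap F G inn out a b h.le ≫ d = s i a h by
    obtain ⟨d, hd, hd'⟩ := this
    exact ⟨d, fun ⟨i, a⟩ h => (hd i a h).trans (hs i i a a le_rfl h).2,
      fun d' h' => hd' _ (fun i a h => (h' _ h).trans (hs i i a a le_rfl h).2.symm)⟩
  replace hs := fun i i' a a' hle h' => (hs i i' a a' hle h').1
  have hlt {i : J} (a : K i) (hi : i < j) (b : K j) : lexMk i a < lexMk j b :=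
    lexMk_lt_iff.2 (Or.inl hi)
  have hlt' {a b : K j} (hab : a < b) : lexMk j a < lexMk j b := lexMk_lt_iff.2 (Or.inr ⟨rfl, hab⟩)
  have hle' {a b : K j} (hab : a ≤ b) : lexMk j a ≤ lexMk j b := lexMk_le_iff.2 (Or.inr ⟨rfl, hab⟩)
  by_cases hb : IsMin b
  · obtain rfl := hb.eq_bot
    have hj : ¬ IsMin j := fun hj => hm.1 (by
      rintro ⟨i, a⟩ hle
      obtain hi | ⟨rfl, ha⟩ := lexMk_le_iff.1 hle
      · exact (hj.not_lt hi).elim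
      · exact hle' bot_le)
    obtain ⟨d, hd, hd'⟩ := existsUnique_desc_lex_Iio h hG hj (fun i a hi => s i a (hlt a hi _))
      (fun i i' a a' hle hi hi' => hs i i' a a' hle _)
    refine ⟨inv (inn j ⊥) ≫ d, fun i a hia => ?_, fun d' h' => ?_⟩
    · obtain hi | ⟨rfl, ha⟩ := lexMk_lt_iff.1 hia
      · rw [lexMap_of_lt _ _ _ _ _ _ _ hi, ← hd _ _ hi]
        simp
      · exact (not_lt_bot ha).elim
    · rw [IsIso.eq_inv_comp]
      refine hd' _ (fun i a hi => ?_)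
      have := h' i a (hlt a hi _)
      rw [lexMap_of_lt _ _ _ _ _ _ _ hi] at this
      simpa using this
  · have hbl : Order.IsSuccLimit b := by
      refine ⟨hb, fun a hab => ?_⟩
      refine hm.2 (lexMk j a) ⟨hlt' hab.1, ?_⟩
      rintro ⟨i, c⟩ h₁ h₂
      obtain hi | ⟨rfl, hc⟩ := lexMk_lt_iff.1 h₁ <;> obtain hi' | ⟨h', hc'⟩ := lexMk_lt_iff.1 h₂
      · exact (hi.trans hi').false
      · exact hi.ne h'.symm
      · exact hi'.false
      · exact hab.2 hc hc'
    obtain ⟨d, hd, hd'⟩ := existsUnique_desc_of_isSuccLimit (F := G j) hbl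
      (fun a ha => s j a (hlt' ha)) (fun a a' haa' ha' => by
        have := hs j j a a' (hle' haa') (hlt' ha')
        rwa [lexMap_self _ _ _ _ _ _ _ haa'] at this)
    have hd₂ (a : K j) (ha : a < b) :
        lexMap F G inn out a b (hle' ha.le) ≫ d = s j a (hlt' ha) := by
      rw [lexMap_self _ _ _ _ _ _ _ ha.le, hd a ha]
    refine ⟨d, fun i a hia => ?_, fun d' h' => hd' _ (fun a ha => ?_)⟩
    · obtain hi | ⟨rfl, ha⟩ := lexMk_lt_iff.1 hia
      · rw [← hs i j a ⊥ (hlt a hi _).le (hlt' hbl.bot_lt), ← hd₂ _ hbl.bot_lt, ← Category.assoc,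
          lexMap_comp h]
      · exact hd₂ a ha
    · rw [← h' j a (hlt' ha), lexMap_self _ _ _ _ _ _ _ ha.le]

end LexSum

/-- A transfinite composition of transfinite compositions is a transfinite composition. -/
lemma transfiniteCompositions_of_transfiniteCompositions {W : MorphismProperty C}
    (hW : MorphismProperty.isomorphisms C ≤ W) {J : Type w} [LinearOrder J] [SuccOrder J]
    [OrderBot J] [WellFoundedLT J] [NoMaxOrder J] {X Y : C} {f : X ⟶ Y}
    (hf : (MorphismProperty.transfiniteCompositions.{w} W).transfiniteCompositionsOfShape J f) :
    MorphismProperty.transfiniteCompositions.{w} W f := by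
  obtain ⟨t⟩ := hf
  have ht (j : J) := (MorphismProperty.transfiniteCompositions_iff _ _).1
    (t.map_mem j (not_isMax j))
  choose K _ _ _ _ ht' using ht
  let r (j : J) := (ht' j).some
  let inn (j : J) (k : K j) : t.F.obj j ⟶ (r j).F.obj k :=
    (r j).isoBot.inv ≫ (r j).F.map (homOfLE bot_le)
  let out (j : J) (k : K j) : (r j).F.obj k ⟶ t.F.obj (Order.succ j) := (r j).incl.app k
  have hmo (j : J) {k k' : K j} (h : k ≤ k') : (r j).F.map (homOfLE h) ≫ out j k' = out j k :=
    ((r j).incl.naturality (homOfLE h)).trans (Category.comp_id _)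
  have h : LexCompat t.F (fun j => (r j).F) inn out :=
    { inn_map j k k' h := by
        dsimp only [inn]
        rw [Category.assoc, ← Functor.map_comp]
        rfl
      map_out j k k' h := hmo j h
      inn_out j k := by
        dsimp only [inn]
        rw [Category.assoc, hmo]
        exact (r j).fac }
  have hbot (j) : inn j ⊥ = (r j).isoBot.inv :=
    (congr(_ ≫ $((r j).F.map_id ⊥))).trans (Category.comp_id _)
  have hbot' (j) : IsIso (inn j ⊥) := by rw [hbot]; infer_instance
  have hG (j) : IsColimit (Cocone.mk (t.F.obj (Order.succ j))
      { app := out j, naturality := fun _ _ f => (h.map_out j (leOfHom f)).trans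
          (Category.comp_id _).symm } : Cocone (r j).F) := (r j).isColimit
  have hincl {i j : J} (a : K i) (b : K j) (hle : lexMk i a ≤ lexMk j b) :
      lexMap t.F (fun j => (r j).F) inn out a b hle ≫ out j b ≫ t.incl.app (Order.succ j) =
        out i a ≫ t.incl.app (Order.succ i) := by
    have ht {i j : J} (h : i ≤ j) : t.F.map (homOfLE h) ≫ t.incl.app j = t.incl.app i :=
      (t.incl.naturality _).trans (Category.comp_id _)
    obtain hij | ⟨rfl, hab⟩ := lexMk_le_iff.1 hle
    · rw [lexMap_of_lt _ _ _ _ _ _ _ hij, Category.assoc, Category.assoc,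
        ← Category.assoc (inn j b), h.inn_out, ht, ht]
    · rw [lexMap_self _ _ _ _ _ _ _ hab, ← Category.assoc, hmo]
  have := wellFoundedLT_sigmaLex (K := K)
  let : SuccOrder (Σₗ j, K j) := SuccOrder.ofLinearWellFoundedLT _
  refine (MorphismProperty.transfiniteCompositions_iff _ _).2
    ⟨Σₗ j, K j, inferInstance, inferInstance, inferInstance, inferInstance, ⟨?_⟩⟩
  exact
    { F := lexFunctor h
      isoBot := (r ⊥).isoBot ≪≫ t.isoBot
      isWellOrderContinuous := isWellOrderContinuous_lexFunctor h hbot' hG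
      incl :=
        { app p := out (ofLex p).1 (ofLex p).2 ≫ t.incl.app (Order.succ (ofLex p).1)
          naturality p q f := (hincl _ _ (leOfHom f)).trans (Category.comp_id _).symm }
      isColimit := IsColimit.ofExistsUnique (fun s => by
        obtain ⟨d, hd, hd'⟩ := existsUnique_desc_lex_of_isColimit h t.isColimit
          (fun i a => s.ι.app (lexMk i a))
          (fun i i' a a' hle => s.w (homOfLE hle : lexMk i a ⟶ lexMk i' a'))
        exact ⟨d, fun ⟨i, a⟩ => (Category.assoc _ _ _).trans (hd i a),
          fun d' h' => hd' d' (fun i a => (Category.assoc _ _ _).symm.trans (h' (lexMk i a)))⟩)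
      fac := by
        have h₁ : (r ⊥).isoBot.inv ≫ out ⊥ ⊥ = t.F.map (homOfLE (Order.le_succ ⊥)) := (r ⊥).fac
        have h₂ : t.F.map (homOfLE (Order.le_succ ⊥)) ≫ t.incl.app (Order.succ ⊥) =
          t.incl.app ⊥ := (t.incl.naturality _).trans (Category.comp_id _)
        change (t.isoBot.inv ≫ (r ⊥).isoBot.inv) ≫ out ⊥ ⊥ ≫ t.incl.app (Order.succ ⊥) = f
        rw [Category.assoc, reassoc_of% h₁, h₂]
        exact t.fac
      map_mem p hp := by
        obtain ⟨i, a⟩ := p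
        -- the successor of `a` in its summand, or else the least element of the next summand
        suffices ∃ q : Σₗ j, K j, lexMk i a ⋖ q ∧ ∀ hq, W ((lexFunctor h).map
            (homOfLE hq : lexMk i a ⟶ q)) by
          obtain ⟨q, hq, hq'⟩ := this
          obtain rfl := hq.succ_eq
          exact hq' _
        by_cases ha : IsMax a
        · refine ⟨lexMk (Order.succ i) ⊥, ⟨lexMk_lt_iff.2 (Or.inl (Order.lt_succ i)), ?_⟩,
            fun hq => ?_⟩
          · rintro ⟨j, b⟩ h₁ h₂
            obtain hi | ⟨rfl, hb⟩ := lexMk_lt_iff.1 h₁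
            · obtain hi' | ⟨rfl, hb⟩ := lexMk_lt_iff.1 h₂
              · exact (Order.le_of_lt_succ hi').not_gt hi
              · exact not_lt_bot hb
            · exact ha.not_lt hb
          · have h₁ : IsIso (out i a) := by
              refine (hG i).isIso_ι_app_of_isTerminal a (IsTerminal.ofUniqueHom
                (fun b => homOfLE (le_of_not_gt ha.not_lt)) (fun _ _ => Subsingleton.elim _ _))
            have h₂ : IsIso (t.F.map (homOfLE (Order.succ_le_of_lt (Order.lt_succ i)))) := by
              have h₃ : t.F.map (homOfLE (Order.succ_le_of_lt (Order.lt_succ i))) = 𝟙 _ :=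
                t.F.map_id _
              rw [h₃]
              infer_instance
            apply hW
            change IsIso (lexMap t.F (fun j => (r j).F) inn out a ⊥ hq)
            rw [lexMap_of_lt _ _ _ _ _ _ _ (Order.lt_succ i)]
            infer_instance
        · refine ⟨lexMk i (Order.succ a), ⟨lexMk_lt_iff.2 (Or.inr ⟨rfl,
            Order.lt_succ_of_not_isMax ha⟩), ?_⟩, fun hq => ?_⟩
          · rintro ⟨j, b⟩ h₁ h₂
            obtain hi | ⟨rfl, hb⟩ := lexMk_lt_iff.1 h₁ <;>
            obtain hi' | ⟨h', hb'⟩ := lexMk_lt_iff.1 h₂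
            · exact (hi.trans hi').false
            · exact hi.ne h'.symm
            · exact hi'.false
            · exact (Order.le_of_lt_succ hb').not_gt hb
          · change W (lexMap t.F (fun j => (r j).F) inn out a (Order.succ a) hq)
            rw [lexMap_self _ _ _ _ _ _ _ (Order.le_succ a)]
            exact (r i).map_mem a ha }

/-! ### Wide pushouts as transfinite compositions -/

/-- The coproducts of the initial segments of a family of objects indexed by a linear order. -/
lemma exists_coproducts_of_initialSegments {D : Type*} [Category* D] [HasColimitsOfSize.{w, w} D]
    {T : Type w} [LinearOrder T] (Y : T → D) :
    ∃ (Z : WithTop T ⥤ D) (ι : ∀ (k : WithTop T) (t : T), t < k → (Y t ⟶ Z.obj k)),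
      (∀ (k k' : WithTop T) (h : k ≤ k') (t : T) (ht : t < k),
        ι k t ht ≫ Z.map (homOfLE h) = ι k' t (ht.trans_le h)) ∧
      ∀ (k : WithTop T) (E : D) (s : ∀ t : T, t < k → (Y t ⟶ E)),
        ∃! d : Z.obj k ⟶ E, ∀ t ht, ι k t ht ≫ d = s t ht := by
  let S (k : WithTop T) : Type w := {t : T // t < k}
  let ι (k : WithTop T) (t : T) (ht : t < k) : Y t ⟶ ∐ fun t : S k => Y t.1 :=
    Sigma.ι (fun t : S k => Y t.1) ⟨t, ht⟩
  have hex (k : WithTop T) (E : D) (s : ∀ t : T, t < k → (Y t ⟶ E)) :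
      ∃! d : (∐ fun t : S k => Y t.1) ⟶ E, ∀ t ht, ι k t ht ≫ d = s t ht :=
    ⟨Sigma.desc (fun t => s t.1 t.2), fun t ht => Sigma.ι_desc _ _,
      fun d hd => Sigma.hom_ext _ _ (fun t => (hd t.1 t.2).trans
        (Sigma.ι_desc (fun t : S k => s t.1 t.2) t).symm)⟩
  choose m hm hm' using fun (k k' : WithTop T) (h : k ≤ k') =>
    hex k _ (fun t ht => ι k' t (ht.trans_le h))
  exact ⟨
    { obj k := ∐ fun t : S k => Y t.1
      map f := m _ _ (leOfHom f)
      map_id k := (hm' _ _ _ _ (fun t ht => Category.comp_id _)).symm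
      map_comp f g := (hm' _ _ _ _ (fun t ht => by
        have h₁ := hm _ _ (leOfHom f) t ht
        have h₂ := hm _ _ (leOfHom g) t (ht.trans_le (leOfHom f))
        rw [← Category.assoc, h₁, h₂])).symm }, ι, hm, hex⟩

/-- A wide pushout of a family of members of `W` which start at the same object `X` is a
transfinite composition of members of `W`: the members of the family are glued one after the
other. -/
lemma transfiniteCompositions_of_wide_pushout [HasColimitsOfSize.{w, w} C]
    {W : MorphismProperty C} [W.IsStableUnderCobaseChange] {X : C} {T : Type w} (Y : T → Under X)
    (hY : ∀ t, W (Y t).hom) (P : Under X) (j : ∀ t, Y t ⟶ P)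
    (hP : ∀ (E : Under X) (s : ∀ t, Y t ⟶ E), ∃! d : P ⟶ E, ∀ t, j t ≫ d = s t) :
    MorphismProperty.transfiniteCompositions.{w} W P.hom := by
  obtain ⟨_, _⟩ := exists_wellFoundedLT T
  let : OrderBot (WithTop T) := WellFoundedLT.toOrderBot _
  let : SuccOrder (WithTop T) := SuccOrder.ofLinearWellFoundedLT _
  obtain ⟨Z, ι, hι, hex⟩ := exists_coproducts_of_initialSegments Y
  have hext {k : WithTop T} {E : Under X} (d d' : Z.obj k ⟶ E)
      (h : ∀ t ht, ι k t ht ≫ d = ι k t ht ≫ d') : d = d' :=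
    (hex k E (fun t ht => ι k t ht ≫ d')).unique h (fun _ _ => rfl)
  refine (MorphismProperty.transfiniteCompositions_iff _ _).2
    ⟨WithTop T, inferInstance, inferInstance, inferInstance, inferInstance, ?_⟩
  have hcont : Z.IsWellOrderContinuous := by
    refine isWellOrderContinuous_of_existsUnique_desc (fun m hm E s hs => ?_)
    have hlt (t : T) (ht : t < m) : (t : WithTop T) < Order.succ (t : WithTop T) :=
      Order.lt_succ_of_not_isMax (fun h => h.not_lt ht)
    obtain ⟨d, hd, hd'⟩ := hex m E
      (fun t ht => ι _ t (hlt t ht) ≫ s (Order.succ (t : WithTop T)) (hm.succ_lt ht))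
    refine ⟨d, fun k hk => hext _ _ (fun t ht => ?_), fun d' h' => hd' _ (fun t ht => ?_)⟩
    · have ht' := ht.trans hk
      rw [← Category.assoc, hι, hd, ← hs _ k (Order.succ_le_of_lt ht) hk, ← Category.assoc, hι]
    · rw [← h' _ (hm.succ_lt ht), ← Category.assoc, hι]
  choose q hq hq' using fun k => hex k P (fun t _ => j t)
  obtain ⟨z, -, -⟩ := hex ⊥ (Under.mk (𝟙 X)) (fun t ht => (not_lt_bot ht).elim)
  have hpres : PreservesColimitsOfShape (WithTop T) (Under.forget X) := by
    have := IsFiltered.isConnected (WithTop T)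
    infer_instance
  have hpres' : PreservesWellOrderContinuousOfShape (WithTop T) (Under.forget X) :=
    ⟨fun k hk => by
      have : Nonempty (Set.Iio k) := ⟨⟨⊥, hk.bot_lt⟩⟩
      have := IsFiltered.isConnected (Set.Iio k)
      infer_instance⟩
  let tc : (W.inverseImage (Under.forget X)).TransfiniteCompositionOfShape (WithTop T)
      (Under.homMk P.hom (Category.id_comp _) : Under.mk (𝟙 X) ⟶ P) :=
    { F := Z
      isoBot :=
        { hom := z
          inv := Under.homMk (Z.obj ⊥).hom (Category.id_comp _)
          hom_inv_id := hext _ _ (fun t ht => (not_lt_bot ht).elim)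
          inv_hom_id := by
            ext
            exact Under.w z }
      isWellOrderContinuous := hcont
      incl :=
        { app := q
          naturality k k' f := hext _ _ (fun t ht => by
            have h₁ := hι k k' (leOfHom f) t ht
            have h₂ := hq k t ht
            have h₃ := hq k' t (ht.trans_le (leOfHom f))
            refine Eq.trans ?_ (congr(ι k t ht ≫ $(Category.comp_id (q k)))).symm
            rw [h₂, ← h₃, ← h₁, Category.assoc]
            rfl) }
      isColimit := IsColimit.ofExistsUnique (fun s => by
        obtain ⟨d, hd, hd'⟩ := hP s.pt (fun t => ι ⊤ t (WithTop.coe_lt_top t) ≫ s.ι.app ⊤)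
        refine ⟨d, fun k => hext _ _ (fun t ht => ?_), fun d' h' => hd' _ (fun t => ?_)⟩
        · have h₁ := hq k t ht
          rw [← Category.assoc, h₁, hd, ← hι k ⊤ le_top t ht, Category.assoc, s.w]
        · have h₁ := hq ⊤ t (WithTop.coe_lt_top t)
          rw [← h' ⊤, ← h₁, Category.assoc])
      fac := by
        ext
        exact Under.w (q ⊥)
      map_mem k hk := by
        obtain ⟨t, rfl⟩ : ∃ t : T, t = k := by
          rw [isMax_iff_eq_top] at hk
          exact WithTop.ne_top_iff_exists.1 hk
        have hlt : (t : WithTop T) < Order.succ (t : WithTop T) := Order.lt_succ_of_not_isMax hk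
        have sq : IsPushout (Z.obj t).hom (Y t).hom
            (Z.map (homOfLE (Order.le_succ (t : WithTop T)))).right (ι _ t hlt).right := by
          refine isPushout_of_existsUnique ((Under.w _).trans (Under.w _).symm)
            (fun E x y hxy => ?_)
          let x' : Z.obj t ⟶ Under.mk ((Z.obj t).hom ≫ x) := Under.homMk x rfl
          let y' : Y t ⟶ Under.mk ((Z.obj t).hom ≫ x) := Under.homMk y hxy.symm
          obtain ⟨s, hs, hs'⟩ : ∃ s : ∀ t' : T, (t' : WithTop T) < Order.succ (t : WithTop T) →
              (Y t' ⟶ Under.mk ((Z.obj t).hom ≫ x)),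
              (∀ (t' : T) ht' (h : (t' : WithTop T) < t), s t' ht' = ι t t' h ≫ x') ∧
              s t hlt = y' := by
            refine ⟨fun t' ht' => if h : t' = t then eqToHom (by rw [h]) ≫ y' else
              ι t t' (lt_of_le_of_ne (Order.le_of_lt_succ ht')
                (fun h' => h (WithTop.coe_injective h'))) ≫ x', fun t' ht' h => ?_, ?_⟩
            · exact dif_neg (fun h' => h.ne (by rw [h']))
            · exact (dif_pos rfl).trans (by simp)
          obtain ⟨d, hd, hd'⟩ := hex (Order.succ (t : WithTop T)) _ s
          have hd₁ : Z.map (homOfLE (Order.le_succ (t : WithTop T))) ≫ d = x' :=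
            hext _ _ (fun t' ht' => by
              rw [← Category.assoc, hι, hd, hs])
          have hd₂ : ι _ t hlt ≫ d = y' := by rw [hd, hs']
          refine ⟨d.right, ⟨congr($(hd₁).right), congr($(hd₂).right)⟩, fun e he => ?_⟩
          have hw : (Z.obj t).hom ≫ (Z.map (homOfLE (Order.le_succ (t : WithTop T)))).right =
            (Z.obj (Order.succ (t : WithTop T))).hom := Under.w _
          let e' : Z.obj (Order.succ (t : WithTop T)) ⟶ Under.mk ((Z.obj t).hom ≫ x) :=
            Under.homMk e (by
              rw [← hw, Category.assoc, he.1]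
              rfl)
          have he₁ : Z.map (homOfLE (Order.le_succ (t : WithTop T))) ≫ e' = x' := by
            ext
            exact he.1
          have he' : e' = d := hd' _ (fun t' ht' => by
            obtain h | h := (Order.le_of_lt_succ ht').lt_or_eq
            · rw [hs t' ht' h, ← he₁, ← Category.assoc, hι]
            · obtain rfl := WithTop.coe_injective h
              rw [hs']
              ext
              exact he.2)
          exact congr($(he').right)
        exact W.of_isPushout sq (hY t) }
  exact ⟨tc.map⟩

/-! ### Gluing solutions of all lifting problems -/

section Step

variable {T : Type w} {a b : T → C}

/-- A commutative square from `g t` to `f` whose pushout `X ⟶ X ⊔ b t`, where `X` is the source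
of `f`, belongs to `W`. -/
structure IsTask [HasPushouts C] (W : MorphismProperty C) (g : ∀ t, a t ⟶ b t) (f : Arrow C)
    (t : T) (s : a t ⟶ f.left) (y : b t ⟶ f.right) : Prop where
  w : s ≫ f.hom = g t ≫ y
  mem : W (pushout.inl s (g t))

variable [HasPushouts C] {W : MorphismProperty C} {g : ∀ t, a t ⟶ b t}

lemma IsTask.map [W.IsStableUnderCobaseChange] {f f' : Arrow C} (φ : f ⟶ f') {t : T}
    {s : a t ⟶ f.left} {y : b t ⟶ f.right} (h : IsTask W g f t s y) :
    IsTask W g f' t (s ≫ φ.left) (y ≫ φ.right) where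
  w := by
    rw [Category.assoc, Arrow.w, reassoc_of% h.w]
  mem := by
    have sq := IsPushout.of_hasPushout s (g t)
    have sq' := IsPushout.of_hasPushout (s ≫ φ.left) (g t)
    have h₁ : IsPushout φ.left (pushout.inl s (g t)) (pushout.inl (s ≫ φ.left) (g t))
        (sq.desc (φ.left ≫ pushout.inl (s ≫ φ.left) (g t)) (pushout.inr _ _)
          (by rw [← Category.assoc, sq'.w])) :=
      IsPushout.of_left (by rwa [sq.inr_desc]) (by rw [sq.inl_desc]) sq
    exact W.of_isPushout h₁ h.mem

/-- The wide pushout `Z`, under the source of `f`, of the pushouts given by all tasks of `f`. -/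
lemma exists_step_obj [HasColimitsOfSize.{w, w} C] [LocallySmall.{w} C]
    [W.IsStableUnderCobaseChange] (f : Arrow C) :
    ∃ (Z : C) (i : f.left ⟶ Z) (ι : ∀ t s y, IsTask W g f t s y → (b t ⟶ Z)),
      MorphismProperty.transfiniteCompositions.{w} W i ∧
      (∀ t s y h, s ≫ i = g t ≫ ι t s y h) ∧
      ∀ (E : C) (u : f.left ⟶ E) (v : ∀ t s y, IsTask W g f t s y → (b t ⟶ E)),
        (∀ t s y h, s ≫ u = g t ≫ v t s y h) →
        ∃! d : Z ⟶ E, i ≫ d = u ∧ ∀ t s y h, ι t s y h ≫ d = v t s y h := by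
  let S : Type _ := Σ' (t : T) (s : a t ⟶ f.left) (y : b t ⟶ f.right), IsTask W g f t s y
  have : Small.{w} S := by
    have : Small.{w} (Σ t : T, (a t ⟶ f.left) × (b t ⟶ f.right)) := inferInstance
    exact small_of_injective (f := fun x : S => (⟨x.1, x.2.1, x.2.2.1⟩ :
      Σ t : T, (a t ⟶ f.left) × (b t ⟶ f.right))) (by
        rintro ⟨t, s, y, h⟩ ⟨t', s', y', h'⟩ hx
        simp only [Sigma.mk.injEq] at hx
        obtain ⟨rfl, hx⟩ := hx
        simp only [heq_eq_eq, Prod.mk.injEq] at hx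
        obtain ⟨rfl, rfl⟩ := hx
        rfl)
  let e := equivShrink.{w} S
  let Y (x : S) : Under f.left := Under.mk (pushout.inl x.2.1 (g x.1))
  have : HasCoproductsOfShape S (Under f.left) := hasCoproductsOfShape_of_small.{w} _ S
  have hP (E : Under f.left) (s : ∀ x, Y x ⟶ E) : ∃! d : ∐ Y ⟶ E, ∀ x, Sigma.ι Y x ≫ d = s x :=
    ⟨Sigma.desc s, fun x => Sigma.ι_desc _ _,
      fun d hd => Sigma.hom_ext _ _ (fun x => (hd x).trans (Sigma.ι_desc s x).symm)⟩
  have hZ : MorphismProperty.transfiniteCompositions.{w} W (∐ Y).hom := by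
    refine transfiniteCompositions_of_wide_pushout (fun x => Y (e.symm x))
      (fun x => (e.symm x).2.2.2.mem) (∐ Y) (fun x => Sigma.ι Y (e.symm x)) (fun E s => ?_)
    obtain ⟨d, hd, hd'⟩ := hP E (e.symm.piCongrLeft (fun x => Y x ⟶ E) s)
    refine ⟨d, fun x => ?_, fun d' h' => hd' d' (fun x => ?_)⟩
    · exact (hd _).trans (Equiv.piCongrLeft_apply_apply (fun x => Y x ⟶ E) e.symm s x)
    · obtain ⟨x, rfl⟩ := e.symm.surjective x
      exact (h' x).trans (Equiv.piCongrLeft_apply_apply (fun x => Y x ⟶ E) e.symm s x).symm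
  have hι (x : S) : pushout.inl x.2.1 (g x.1) ≫ (Sigma.ι Y x).right = (∐ Y).hom :=
    Under.w (Sigma.ι Y x)
  refine ⟨(∐ Y).right, (∐ Y).hom, fun t s y h => pushout.inr s (g t) ≫
    (Sigma.ι Y ⟨t, s, y, h⟩).right, hZ, fun t s y h => ?_, fun E u v huv => ?_⟩
  · rw [← hι ⟨t, s, y, h⟩, pushout.condition_assoc]
  · obtain ⟨d, hd, hd'⟩ := hP (Under.mk u)
      (fun x => Under.homMk (pushout.desc u (v x.1 x.2.1 x.2.2.1 x.2.2.2) (huv _ _ _ _))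
        (pushout.inl_desc _ _ _))
    refine ⟨d.right, ⟨Under.w d, fun t s y h => ?_⟩, fun d' h' => ?_⟩
    · have := congr($(hd ⟨t, s, y, h⟩).right)
      rw [Category.assoc]
      exact congr(pushout.inr s (g t) ≫ $this).trans (pushout.inr_desc _ _ _)
    · refine congr($(hd' (Under.homMk d' h'.1) (fun x => ?_)).right)
      ext
      apply pushout.hom_ext
      · refine Eq.trans ?_ (pushout.inl_desc _ _ _).symm
        exact (Category.assoc _ _ _).symm.trans (congr($(hι x) ≫ d').trans h'.1)
      · refine Eq.trans ?_ (pushout.inr_desc _ _ _).symm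
        exact (Category.assoc _ _ _).symm.trans (h'.2 x.1 x.2.1 x.2.2.1 x.2.2.2)

/-- Gluing a solution of all tasks of `f` to its source, as a functor of `f`. It is functorial since
a morphism `f ⟶ f'` maps tasks to tasks, which is where stability under pushouts is needed. -/
lemma exists_step [HasColimitsOfSize.{w, w} C] [LocallySmall.{w} C] (W : MorphismProperty C)
    [W.IsStableUnderCobaseChange] (g : ∀ t, a t ⟶ b t) :
    ∃ (S : Arrow C ⥤ Arrow C) (ε : 𝟭 (Arrow C) ⟶ S), (∀ f, IsIso (ε.app f).right) ∧
      (∀ f, MorphismProperty.transfiniteCompositions.{w} W (ε.app f).left) ∧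
      ∀ (f : Arrow C) (t : T) (s : a t ⟶ f.left) (y : b t ⟶ f.right), IsTask W g f t s y →
        ∃ l : b t ⟶ (S.obj f).left, g t ≫ l = s ≫ (ε.app f).left ∧
          l ≫ (S.obj f).hom = y ≫ (ε.app f).right := by
  choose Z i ι hi hw hex using exists_step_obj (W := W) (g := g)
  have hext {f : Arrow C} {E : C} {d d' : Z f ⟶ E} (h : i f ≫ d = i f ≫ d')
      (h' : ∀ t s y h, ι f t s y h ≫ d = ι f t s y h ≫ d') : d = d' :=
    (hex f E (i f ≫ d') (fun t s y h => ι f t s y h ≫ d') (fun t s y h => by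
      rw [← Category.assoc, hw, Category.assoc])).unique ⟨h, h'⟩ ⟨rfl, fun _ _ _ _ => rfl⟩
  have hp (f : Arrow C) : ∃ p : Z f ⟶ f.right, i f ≫ p = f.hom ∧
      ∀ t s y h, ι f t s y h ≫ p = y :=
    (hex f f.right f.hom (fun t s y h => y) (fun t s y h => h.w)).exists
  have hm {f f' : Arrow C} (φ : f ⟶ f') : ∃ m : Z f ⟶ Z f', i f ≫ m = φ.left ≫ i f' ∧
      ∀ t s y h, ι f t s y h ≫ m = ι f' t (s ≫ φ.left) (y ≫ φ.right) (h.map φ) :=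
    (hex f (Z f') (φ.left ≫ i f') (fun t s y h => ι f' t (s ≫ φ.left) (y ≫ φ.right) (h.map φ))
      (fun t s y h => by rw [← Category.assoc, hw])).exists
  choose p hp₁ hp₂ using hp
  choose m hm₁ hm₂ using @hm
  have hmp {f f' : Arrow C} (φ : f ⟶ f') : m φ ≫ p f' = p f ≫ φ.right := hext
    (by rw [← Category.assoc, hm₁, Category.assoc, hp₁, ← Category.assoc, hp₁, Arrow.w])
    (fun t s y h => by rw [← Category.assoc, hm₂, hp₂, ← Category.assoc, hp₂])
  let S : Arrow C ⥤ Arrow C :=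
    { obj f := Arrow.mk (p f)
      map φ := Arrow.homMk (m φ) φ.right (hmp φ)
      map_id f := by
        ext
        · exact hext (by simp [hm₁]) (fun t s y h => by simp [hm₂])
        · rfl
      map_comp φ ψ := by
        ext
        · refine hext ?_ (fun t s y h => ?_)
          · simp [hm₁, reassoc_of% (hm₁ φ)]
          · simp [hm₂, reassoc_of% (hm₂ φ)]
        · rfl }
  let ε : 𝟭 (Arrow C) ⟶ S :=
    { app f := Arrow.homMk (i f) (𝟙 _) ((hp₁ f).trans (Category.comp_id _).symm)
      naturality f f' φ := by
        ext
        · exact (hm₁ φ).symm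
        · exact (Category.comp_id _).trans (Category.id_comp _).symm }
  refine ⟨S, ε, fun f => ?_, fun f => hi f, fun f t s y h => ?_⟩
  · change IsIso (𝟙 _)
    infer_instance
  · exact ⟨ι f t s y h, (hw f t s y h).symm, (hp₂ f t s y h).trans (Category.comp_id _).symm⟩

end Step

/-! ### Iteration of the gluing construction -/

section Iteration

variable {T : Type w} {a b : T → C} [HasPushouts C]

/-- A task on an arrow `A` which is performed at the next stage `A'` of an iteration is performed
in the colimit `B`. The targets of `A` and `B` are isomorphic, `Y` being a further copy of them. -/
lemma exists_lift_of_isTask {W : MorphismProperty C} {g : ∀ t, a t ⟶ b t} {A A' B : Arrow C}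
    {Y : C} {φ : A ⟶ A'} {i : A ⟶ B} {i' : A' ⟶ B} (hi : φ ≫ i' = i) [IsIso i.right]
    {m : B.left ⟶ Y} {r : Y ⟶ B.right} (hr : IsIso r) (hm : m ≫ r = B.hom)
    (h : ∀ (t : T) (s : a t ⟶ A.left) (y : b t ⟶ A.right), IsTask W g A t s y →
      ∃ l : b t ⟶ A'.left, g t ≫ l = s ≫ φ.left ∧ l ≫ A'.hom = y ≫ φ.right)
    {t : T} {s : a t ⟶ A.left} {y : b t ⟶ Y} (hs : s ≫ i.left ≫ m = g t ≫ y)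
    (hW : W (pushout.inl s (g t))) :
    ∃ l : b t ⟶ B.left, g t ≫ l = s ≫ i.left ∧ l ≫ m = y := by
  have hw : i.left ≫ B.hom = A.hom ≫ i.right := Arrow.w i
  have hw' : i'.left ≫ B.hom = A'.hom ≫ i'.right := Arrow.w i'
  have hl : φ.left ≫ i'.left = i.left := congr($(hi).left)
  have hφi : φ.right ≫ i'.right = i.right := congr($(hi).right)
  have htask : IsTask W g A t s (y ≫ r ≫ inv i.right) :=
    { w := by
        rw [← cancel_mono i.right]
        simp only [Category.assoc, IsIso.inv_hom_id, Category.comp_id]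
        rw [← hw, ← hm, ← Category.assoc (g t), ← hs]
        simp only [Category.assoc]
      mem := hW }
  obtain ⟨l, hl₁, hl₂⟩ := h t _ _ htask
  refine ⟨l ≫ i'.left, by rw [reassoc_of% hl₁, hl], ?_⟩
  rw [← cancel_mono r, Category.assoc, Category.assoc, hm, hw', reassoc_of% hl₂, hφi]
  simp

open SmallObject in
/-- The iteration of the construction of `exists_step` along `J`, as a functorial factorization: any
task on a stage of the iteration is performed in its colimit. -/
lemma exists_iteration [HasColimitsOfSize.{w, w} C] [LocallySmall.{w} C] (W : MorphismProperty C)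
    [W.IsStableUnderCobaseChange] (g : ∀ t, a t ⟶ b t) (J : Type w) [LinearOrder J] [OrderBot J]
    [SuccOrder J] [WellFoundedLT J] [NoMaxOrder J] :
    ∃ (L : Arrow C ⥤ C) (e : Arrow.leftFunc ⟶ L) (m : L ⟶ Arrow.rightFunc),
      e ≫ m = Arrow.leftToRight ∧
      ∀ f : Arrow C, ∃ h : (MorphismProperty.transfiniteCompositions.{w}
          W).TransfiniteCompositionOfShape J (e.app f : f.left ⟶ L.obj f),
        ∀ (j : J) (t : T) (s : a t ⟶ h.F.obj j) (y : b t ⟶ f.right),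
          s ≫ h.incl.app j ≫ m.app f = g t ≫ y → W (pushout.inl s (g t)) →
          ∃ l : b t ⟶ L.obj f, g t ≫ l = s ≫ h.incl.app j ∧ l ≫ m.app f = y := by
  obtain ⟨S, ε, hε₁, hε₂, hε₃⟩ := exists_step W g
  let Φ : SuccStruct (Arrow C ⥤ Arrow C) := SuccStruct.ofNatTrans ε
  let tc := Φ.transfiniteCompositionOfShapeιIteration J
  let η : 𝟭 (Arrow C) ⟶ Φ.iteration J := Φ.ιIteration J
  have hprop {F G : Arrow C ⥤ Arrow C} {φ : F ⟶ G} (h : Φ.prop φ) (f : Arrow C) :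
      IsIso (φ.app f).right ∧ MorphismProperty.transfiniteCompositions.{w} W (φ.app f).left ∧
      ∀ (t : T) (s : a t ⟶ (F.obj f).left) (y : b t ⟶ (F.obj f).right),
        IsTask W g (F.obj f) t s y →
        ∃ l : b t ⟶ (G.obj f).left, g t ≫ l = s ≫ (φ.app f).left ∧
          l ≫ (G.obj f).hom = y ≫ (φ.app f).right := by
    obtain ⟨F⟩ := h
    exact ⟨hε₁ _, hε₂ _, hε₃ _⟩
  let hl (f : Arrow C) : (MorphismProperty.transfiniteCompositions.{w}
      W).TransfiniteCompositionOfShape J (η.app f).left :=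
    { toTransfiniteCompositionOfShape :=
        tc.toTransfiniteCompositionOfShape.map ((evaluation _ _).obj f ⋙ Arrow.leftFunc)
      map_mem j hj := (hprop (tc.map_mem j hj) f).2.1 }
  let hr (f : Arrow C) : (MorphismProperty.isomorphisms C).TransfiniteCompositionOfShape J
      (η.app f).right :=
    { toTransfiniteCompositionOfShape :=
        tc.toTransfiniteCompositionOfShape.map ((evaluation _ _).obj f ⋙ Arrow.rightFunc)
      map_mem j hj := (hprop (tc.map_mem j hj) f).1 }
  have hη (f) : IsIso (η.app f).right := (hr f).isIso
  let ρ : Arrow.rightFunc ⟶ Φ.iteration J ⋙ Arrow.rightFunc :=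
    Functor.whiskerRight η Arrow.rightFunc
  have hρ : IsIso ρ := by
    have (f : Arrow C) : IsIso (ρ.app f) := hη f
    exact NatIso.isIso_of_isIso_app ρ
  let m : Φ.iteration J ⋙ Arrow.leftFunc ⟶ Arrow.rightFunc :=
    Functor.whiskerLeft (Φ.iteration J) Arrow.leftToRight ≫ inv ρ
  have hm (f : Arrow C) : m.app f ≫ (η.app f).right = ((Φ.iteration J).obj f).hom := by
    have : m ≫ ρ = Functor.whiskerLeft (Φ.iteration J) Arrow.leftToRight := by
      dsimp only [m]
      rw [Category.assoc, IsIso.inv_hom_id, Category.comp_id]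
    exact congr(($this).app f)
  refine ⟨Φ.iteration J ⋙ Arrow.leftFunc, Functor.whiskerRight η Arrow.leftFunc, m, ?_,
    fun f => ⟨hl f, ?_⟩⟩
  · rw [← cancel_mono ρ]
    dsimp only [m]
    rw [Category.assoc, Category.assoc, IsIso.inv_hom_id, Category.comp_id]
    ext f
    exact (Arrow.w (η.app f))
  · intro j t s y hsy hW
    let A (j : J) : Arrow C := (tc.F.obj j).obj f
    obtain ⟨i, hi, hi', hφ⟩ : ∃ i : ∀ j, A j ⟶ (Φ.iteration J).obj f,
        (∀ j, (hl f).incl.app j = (i j).left) ∧ (∀ j, IsIso (i j).right) ∧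
        (tc.F.map (homOfLE (Order.le_succ j))).app f ≫ i (Order.succ j) = i j :=
      ⟨fun j => (tc.incl.app j).app f, fun j => Category.comp_id _,
        fun j => by
          have h₁ : (hr f).incl.app j = ((tc.incl.app j).app f).right := Category.comp_id _
          have h₂ : MorphismProperty.isomorphisms C ((hr f).incl.app j) := (hr f).mem_incl_app j
          rw [h₁] at h₂
          exact h₂,
        congr($((tc.incl.naturality (homOfLE (Order.le_succ j))).trans (Category.comp_id _)).app f)⟩
    have := hi' j
    have hsy' : s ≫ (i j).left ≫ m.app f = g t ≫ y := (congr(s ≫ $(hi j) ≫ m.app f)).symm.trans hsy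
    obtain ⟨l, hl₁, hl₂⟩ := exists_lift_of_isTask (W := W) hφ (hη f) (hm f)
      (hprop (tc.map_mem j (not_isMax j)) f).2.2 hsy' hW
    exact ⟨l, hl₁.trans (congr(s ≫ $(hi j))).symm, hl₂⟩

end Iteration

/-! ### Injectivity and the right lifting property -/

section Injectivity

variable (C κ) in
/-- A locally `κ`-presentable category has a terminal object: it is the object orthogonal to all
morphisms `⊥_ C ⟶ X` with `X` in a set of `κ`-presentable generators. -/
lemma hasTerminal_of_isCardinalLocallyPresentable [IsCardinalLocallyPresentable C κ] :
    HasTerminal C := by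
  have := hasColimitsOfSizeShrink.{0, 0, w, w} C
  obtain ⟨P, _, hP⟩ := HasCardinalFilteredGenerator.exists_small_generator C κ
  let W : MorphismProperty C := .ofHoms (fun p : Subtype P => initial.to p.1)
  have := W.isRightAdjoint_ι_isLocal κ (by
    rintro X Y f ⟨p⟩
    refine ⟨?_, hP.le_isCardinalPresentable _ p.2⟩
    have (k : Discrete PEmpty.{1}) : IsCardinalPresentable ((Functor.empty C).obj k) κ :=
      k.as.elim
    exact isCardinalPresentable_of_isColimit _ (initialIsInitial (C := C)) κ
      (hasCardinalLT_arrow_of_finCategory κ _))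
  let Z := W.isLocal.ι.leftAdjoint.obj (⊥_ C)
  have hZ (p : C) (hp : P p) : ∃! f : p ⟶ Z.obj, True := by
    obtain ⟨f, hf⟩ := (Z.property (initial.to p) (.mk (⟨p, hp⟩ : Subtype P))).2 (initial.to _)
    refine ⟨f, trivial, fun f' _ => (Z.property (initial.to p) (.mk (⟨p, hp⟩ : Subtype P))).1 ?_⟩
    exact initial.hom_ext _ _
  have hZ' (X : C) : ∃ f : X ⟶ Z.obj, ∀ f' : X ⟶ Z.obj, f' = f := by
    obtain ⟨J, _, _, ⟨pr⟩⟩ := hP.exists_colimitsOfShape X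
    refine ⟨pr.isColimit.desc (Cocone.mk Z.obj
      { app j := (hZ _ (pr.prop_diag_obj j)).choose
        naturality j j' f := (hZ _ (pr.prop_diag_obj j)).unique trivial trivial }), fun f' => ?_⟩
    exact pr.isColimit.hom_ext fun j => (hZ _ (pr.prop_diag_obj j)).unique trivial trivial
  choose f hf using hZ'
  exact (IsTerminal.ofUniqueHom f hf).hasTerminal

variable (P : ObjectProperty C)

instance isStableUnderCobaseChange_presentableMembers :
    (presentableMembers (injectiveMorphisms P) κ).IsStableUnderCobaseChange where
  of_isPushout sq h := ⟨injectiveMorphisms_of_isPushout P sq h.1,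
    presentableMorphisms_of_isPushout sq h.2⟩

lemma isomorphisms_le_presentableMembers :
    MorphismProperty.isomorphisms C ≤ presentableMembers (injectiveMorphisms P) κ :=
  fun _ _ f (_ : IsIso f) => ⟨fun _ _ u => ⟨inv f ≫ u, by simp⟩, presentableMorphisms_of_isIso f⟩

/-- For `K` in `P`, the morphism from `K` to the terminal object has the right lifting property with
respect to `κ-P^▽`, so that lifts against it are extensions to `K`. -/
lemma llp_rlp_presentableMembers_le [IsCardinalLocallyPresentable C κ] :
    (presentableMembers (injectiveMorphisms P) κ).rlp.llp ≤ injectiveMorphisms P := by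
  have := hasTerminal_of_isCardinalLocallyPresentable C κ
  intro A B f hf K hK u
  have : HasLiftingProperty f (terminal.from K) := by
    refine hf _ (fun X Y n hn => ⟨fun {s y} sq => ?_⟩)
    obtain ⟨t, ht⟩ := hn.1 K hK s
    exact ⟨⟨{ l := t, fac_left := ht, fac_right := terminal.hom_ext _ _ }⟩⟩
  have sq : CommSq u f (terminal.from K) (terminal.from B) := ⟨terminal.hom_ext _ _⟩
  exact ⟨sq.lift, sq.fac_left⟩

/-- A morphism `m : X ⟶ B` starting at the colimit of a chain has the right lifting property with
respect to the members of `κ-P^▽` as soon as lifts exist for the pushouts of the members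
starting at the terms of the chain. -/
lemma rlp_presentableMembers_of_isColimit [IsCardinalLocallyPresentable C κ]
    {J : Type w} [SmallCategory J] [IsCardinalFiltered J κ] {F : J ⥤ C} {X B : C}
    {ι : F ⟶ (Functor.const J).obj X} (hι : IsColimit (Cocone.mk X ι))
    (hinj : ∀ j, injectiveMorphisms P (ι.app j)) {m : X ⟶ B}
    (hm : ∀ (j : J) (Q : C) (n : F.obj j ⟶ Q) (y : Q ⟶ B),
      presentableMembers (injectiveMorphisms P) κ n → (ι.app j ≫ m : F.obj j ⟶ B) = n ≫ y →
      ∃ l : Q ⟶ X, n ≫ l = ι.app j ∧ l ≫ m = y) :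
    (presentableMembers (injectiveMorphisms P) κ).rlp m := by
  intro A A' n hn
  refine ⟨fun {s t} sq => ?_⟩
  have po := IsPushout.of_hasPushout s n
  have hn' := presentableMorphisms_of_isPushout po hn.2
  obtain ⟨j, Q, n'', q, hn'', po'⟩ := presentableMorphisms.exists_isPushout_of_isColimit hι hn'
  obtain ⟨i, hi⟩ : ∃ i : F.obj j ⟶ X, i = ι.app j := ⟨_, rfl⟩
  replace po' : IsPushout i n'' (pushout.inl s n) q := by rw [hi]; exact po'
  have hT : injectiveMorphisms P n'' := injectiveMorphisms_of_isPushout' P po'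
    (by rw [hi]; exact hinj j) (injectiveMorphisms_of_isPushout P po hn.1)
  let d : pushout s n ⟶ B := pushout.desc m t sq.w
  obtain ⟨l, hl, hl'⟩ := hm j Q n'' (q ≫ d) ⟨hT, hn''⟩ (by
    rw [← hi, ← reassoc_of% po'.w, pushout.inl_desc])
  rw [← hi] at hl
  let r : pushout s n ⟶ X := po'.desc (𝟙 X) l (by rw [hl, Category.comp_id])
  have hr : r ≫ m = d := by
    refine po'.hom_ext ?_ ?_
    · rw [po'.inl_desc_assoc, Category.id_comp, pushout.inl_desc]
    · rw [po'.inr_desc_assoc, hl']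
  refine ⟨⟨{ l := pushout.inr s n ≫ r, fac_left := ?_, fac_right := ?_ }⟩⟩
  · rw [← pushout.condition_assoc]
    exact (congr(s ≫ $(po'.inl_desc _ _ _))).trans (Category.comp_id _)
  · rw [Category.assoc, hr, pushout.inr_desc]

end Injectivity

/-! ### The functorial weak factorization system -/

variable (κ) in
/-- The iteration of length `κ` performing all tasks given by `κ-P^▽` and a representative set of
`κ`-presentable morphisms. -/
lemma exists_functorial_factorization [IsCardinalLocallyPresentable C κ] (P : ObjectProperty C) :
    ∃ (L : Arrow C ⥤ C) (e : Arrow.leftFunc ⟶ L) (m : L ⟶ Arrow.rightFunc),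
      e ≫ m = Arrow.leftToRight ∧ ∀ f : Arrow C,
        chains.{w} (presentableMembers (injectiveMorphisms P) κ) (e.app f) ∧
        (presentableMembers (injectiveMorphisms P) κ).rlp (m.app f) := by
  obtain ⟨T, a, b, g, hg⟩ := exists_small_family_isPushout C κ
  let N : MorphismProperty C := presentableMembers (injectiveMorphisms P) κ
  have hκ : κ.IsRegular := Fact.out
  have := Cardinal.noMaxOrder hκ.aleph0_le
  have : Nonempty κ.ord.ToType := by simpa using hκ.ne_zero
  let _ : OrderBot κ.ord.ToType := WellFoundedLT.toOrderBot κ.ord.ToType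
  obtain ⟨L, e, m, fac, hL⟩ := exists_iteration N g κ.ord.ToType
  refine ⟨L, e, m, fac, fun f => ?_⟩
  obtain ⟨h, hlift⟩ := hL f
  refine ⟨transfiniteCompositions_of_transfiniteCompositions
    (isomorphisms_le_presentableMembers P) h.mem, ?_⟩
  refine rlp_presentableMembers_of_isColimit P h.isColimit (fun j => ?_) ?_
  · exact llp_rlp_presentableMembers_le P _
      ((h.ofLE N.transfiniteCompositions_le_llp_rlp).mem_incl_app j)
  · intro j Q n (y : Q ⟶ f.right) hn hy
    obtain ⟨t, x, z, sq⟩ := hg n hn.2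
    have hW : N (pushout.inl x (g t)) := by
      have : N (n ≫ sq.isoPushout.hom) :=
        MorphismProperty.RespectsIso.postcomp N sq.isoPushout.hom n hn
      rwa [sq.inl_isoPushout_hom] at this
    obtain ⟨i, hi⟩ : ∃ i : h.F.obj j ⟶ L.obj f, i = h.incl.app j := ⟨_, rfl⟩
    obtain ⟨p, hp⟩ : ∃ p : L.obj f ⟶ f.right, p = m.app f := ⟨_, rfl⟩
    have hy : i ≫ p = n ≫ y := by rw [hi, hp]; exact hy
    obtain ⟨l, hl₁, hl₂⟩ : ∃ l : b t ⟶ L.obj f, g t ≫ l = x ≫ i ∧ l ≫ p = z ≫ y := by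
      have hw : x ≫ i ≫ p = g t ≫ z ≫ y := by rw [hy, sq.w_assoc]
      have := hlift j t x (z ≫ y)
      rw [← hi, ← hp] at this
      exact this hw hW
    rw [← hi]
    suffices ∃ l : Q ⟶ L.obj f, n ≫ l = i ∧ l ≫ p = y by rwa [hp] at this
    refine ⟨sq.desc i l hl₁.symm, sq.inl_desc _ _ _, sq.hom_ext ?_ ?_⟩
    · rw [sq.inl_desc_assoc, hy]
    · rw [sq.inr_desc_assoc, hl₂]

/-- Retracts in the comma categories inherit the left lifting property. -/
lemma commaRetracts_llp_le (W : MorphismProperty C) : commaRetracts W.llp ≤ W.llp := by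
  rintro A B f ⟨X, g, hg, ⟨r⟩⟩
  obtain ⟨i, hi⟩ : ∃ i : B ⟶ X, i = r.i.right := ⟨_, rfl⟩
  obtain ⟨q, hq⟩ : ∃ q : X ⟶ B, q = r.r.right := ⟨_, rfl⟩
  have hfi : f ≫ i = g := by rw [hi]; exact Under.w r.i
  have hgq : g ≫ q = f := by rw [hq]; exact Under.w r.r
  have hiq : i ≫ q = 𝟙 B := by rw [hi, hq]; exact congr($(r.retract).right)
  refine W.llp.of_retract (f := f) (g := g)
    { i := Arrow.homMk (𝟙 A) i (by simp [hfi])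
      r := Arrow.homMk (𝟙 A) q (by simp [hgq])
      retract := by ext <;> simp [hiq] } hg

/-- The retract argument. -/
lemma commaRetracts_of_llp {W R : MorphismProperty C} {A X B : C} {e : A ⟶ X} {m : X ⟶ B}
    (he : W e) (hm : R m) (hf : R.llp (e ≫ m)) : commaRetracts W (e ≫ m) := by
  have := hf m hm
  have sq : CommSq e (e ≫ m) m (𝟙 B) := ⟨by simp⟩
  exact ⟨X, e, he, ⟨{ i := Under.homMk sq.lift sq.fac_left
                      r := Under.homMk m
                      retract := by ext; exact sq.fac_right }⟩⟩

variable (κ) in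
/-- The class `κ-P^▽` determines a functorial weak factorization system. Since it is stable under
pushouts, the left class is obtained by transfinite compositions and retracts alone. -/
lemma isWeakFactorizationSystem_retractsOfChains [IsCardinalLocallyPresentable C κ]
    (P : ObjectProperty C) {N : MorphismProperty C}
    (hN : N = presentableMembers (injectiveMorphisms P) κ) :
    MorphismProperty.IsWeakFactorizationSystem (retractsOfChains.{w} N) N.rlp ∧
    MorphismProperty.HasFunctorialFactorization (retractsOfChains.{w} N) N.rlp := by
  subst hN
  let N := presentableMembers (injectiveMorphisms P) κ
  obtain ⟨L, e, m, fac, h⟩ := exists_functorial_factorization κ P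
  have fac' {A B : C} (f : A ⟶ B) : (e.app (Arrow.mk f) ≫ m.app (Arrow.mk f) : A ⟶ B) = f :=
    congr(($fac).app (Arrow.mk f))
  have hN : chains.{w} N ≤ retractsOfChains.{w} N := fun A B f hf => ⟨B, f, hf, ⟨Retract.refl _⟩⟩
  have hllp : N.rlp.llp = retractsOfChains.{w} N := by
    refine le_antisymm (fun A B f hf => ?_) ?_
    · rw [← fac' f] at hf ⊢
      exact commaRetracts_of_llp (h (Arrow.mk f)).1 (h (Arrow.mk f)).2 hf
    · refine le_trans ?_ (commaRetracts_llp_le N.rlp)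
      rintro A B f ⟨X, g, hg, hr⟩
      exact ⟨X, g, N.transfiniteCompositions_le_llp_rlp _ hg, hr⟩
  have : MorphismProperty.HasFunctorialFactorization (retractsOfChains.{w} N) N.rlp :=
    ⟨⟨{ Z := L, i := e, p := m, fac := fac, hi := fun f => hN _ (h f).1, hp := fun f => (h f).2 }⟩⟩
  exact ⟨{ rlp := by rw [← hllp, MorphismProperty.rlp_llp_rlp], llp := hllp }, this⟩

end PresentableMorphisms

theorem theorem1p3 {C : Type u} [Category.{v} C] (κ : Cardinal.{w}) [Fact κ.IsRegular]
    [IsCardinalLocallyPresentable C κ]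
    (M : MorphismProperty C) (hM : M ≤ PresentableMorphisms.presentableMorphisms C κ)
    (N N₁ : MorphismProperty C)
    (hN : N = PresentableMorphisms.presentableMembers
      (PresentableMorphisms.injectiveMorphisms (PresentableMorphisms.injectiveObjects M)) κ)
    (hN₁ : N₁ = PresentableMorphisms.presentableMembers
      (PresentableMorphisms.orthogonalMorphisms (PresentableMorphisms.orthogonalObjects M)) κ) :
    (MorphismProperty.IsWeakFactorizationSystem
        (PresentableMorphisms.retractsOfChains.{w} N) N.rlp ∧
      MorphismProperty.HasFunctorialFactorization
        (PresentableMorphisms.retractsOfChains.{w} N) N.rlp) ∧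
    PresentableMorphisms.IsFactorizationSystem
      (PresentableMorphisms.filteredColimits N₁ κ)
      (PresentableMorphisms.orthogonalRight N₁) := by
  subst hN₁
  refine ⟨PresentableMorphisms.isWeakFactorizationSystem_retractsOfChains κ _ hN,
    PresentableMorphisms.isFactorizationSystem_of_exists_factorization _
    (fun A B f => PresentableMorphisms.exists_factorization_filteredColimits _ f)⟩
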